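/- Let $E$ be a finite or countable set, let $|\cdot|$ be an arbitrary norm on $\mathbb{R}^d$, and let $(X_t)_{t\in\mathbb{Z}}$ be a stationary and ergodic process with values in $\mathbb{R}^d$. For a process $(Z_t)_{t\in\mathbb Z}$ write $Z_t^-=(Z_{t-j})_{j\ge 0}$. Let $\mathcal{D}\subset(\mathbb{R}^d)^{\mathbb{N}}$ be measurable with $\mathbb{P}(X_{-1}^-\in\mathcal{D})=1$, let $P$ be a transition kernel from $E^{\mathbb{N}}\times\mathcal{D}$ to $E$, and let $(Y_t)_{t\in\mathbb{Z}}$ be an $E$-valued process such that, for all $t\in\mathbb{Z}$ and $y\in E$, almost surely $$\mathbb{P}(Y_t=y\mid Y_{t-1}^-,X_{t-1}^-)=P(y\mid Y_{t-1}^-,X_{t-1}^-)\quad\text{and}\quad \mathbb{P}(Y_t=y\mid Y_{t-1}^-,X_{t-1}^-)=\mathbb{P}(Y_t=y\mid Y_{t-1}^-,(X_s)_{s\in\mathbb{Z}}),$$ the second identity being the strict exogeneity of the covariates. Let $d_{TV}(\mu,\nu)=\frac12\sum_{y\in E}|\mu(y)-\nu(y)|$ and assume: (A3) $\displaystyle\sup_{y,y'\in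 E^{\mathbb{N}}}\sup_{x\in\mathcal{D}}d_{TV}(P(\cdot\mid y,x),P(\cdot\mid y',x))<1$; (A4) there are nonnegative sequences $(a_j)_{j\ge0}$, $(e_j)_{j\ge0}$ with $\sum_{j} j a_j<\infty$ and $\sum_j e_j<\infty$ such that, for all $y,y'\in E^{\mathbb{N}}$ and $x,x'\in\mathcal{D}$, $$d_{TV}(P(\cdot\mid y,x),P(\cdot\mid y',x'))\le\sum_{i\ge0}a_i\mathbf{1}_{y_i\ne y_i'}+\sum_{j\ge0}e_j|x_j-x_j'|.$$ For $m\ge 0$ put $$b_m=\sup\{d_{TV}(P(\cdot\mid y,x),P(\cdot\mid y',x)):\ y,y'\in E^{\mathbb{N}},\ x\in\mathcal{D},\ y_j=y'_j\text{ for }0\le j\le m-1\},$$ and put $b_0^*=b_0$ and, for $n\ge1$, $b_n^*=\mathbb{P}(T_n=0)$, where $(T_n)_{n\ge0}$ is the time-homogeneous Markov chain on $\mathbb{N}$ with $T_0=0$ and transition probabilities $Q(i,i+1)=1-b_i$, $Q(i,0)=b_i$. Let $S_j=\sum_{t\ge j}e_t$, $(u*v)_n=\sum_{j=0}^n u_jv_{n-j}$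 and $\|X_0\|_1=\mathbb{E}|X_0|$. For a process $(V_t)_{t\in\mathbb{Z}}$ let $$\alpha_V(n)=\sup\{|\mathbb{P}(A\cap B)-\mathbb{P}(A)\mathbb{P}(B)|:\ A\in\sigma(V_j:j\le0),\ B\in\sigma(V_j:j\ge n)\}.$$ Then, with $V_t=(Y_t,X_t)$, for all integers $1<r<n$, $$\alpha_V(n)\le4\alpha_X(r)+2\sum_{t\ge n-r-1}b_t^*+4\|X_0\|_1\sum_{t\ge n-r}S_t+4\|X_0\|_1\sum_{t\ge n-r-1}(b^**S)_t,$$ where the right-hand side is taken in $[0,\infty]$ with $\infty\cdot0=0$. -/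

import Mathlib

open MeasureTheory ProbabilityTheory

noncomputable section

namespace InfiniteMemory

/-- Strong mixing coefficient `α(𝓕, 𝓖)` of two σ-algebras under `μ`. -/
def alphaCoeff {Ω : Type*} [MeasurableSpace Ω] (μ : Measure Ω) (𝓕 𝓖 : MeasurableSpace Ω) : ℝ :=
  sSup {c : ℝ | ∃ A B : Set Ω, MeasurableSet[𝓕] A ∧ MeasurableSet[𝓖] B ∧
    c = |μ.real (A ∩ B) - μ.real A * μ.real B|}

/-- `σ(V_j : j ≤ k)`. -/
def sigmaLE {Ω H : Type*} [MeasurableSpace H] (V : ℤ → Ω → H) (k : ℤ) : MeasurableSpace Ω :=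
  ⨆ j : ℤ, ⨆ _ : j ≤ k, MeasurableSpace.comap (V j) inferInstance

/-- `σ(V_j : j ≥ k)`. -/
def sigmaGE {Ω H : Type*} [MeasurableSpace H] (V : ℤ → Ω → H) (k : ℤ) : MeasurableSpace Ω :=
  ⨆ j : ℤ, ⨆ _ : k ≤ j, MeasurableSpace.comap (V j) inferInstance

/-- `σ(V_j : j ∈ ℤ)`. -/
def sigmaAll {Ω H : Type*} [MeasurableSpace H] (V : ℤ → Ω → H) : MeasurableSpace Ω :=
  ⨆ j : ℤ, MeasurableSpace.comap (V j) inferInstance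

/-- `α_V(n) = α(σ(V_j : j ≤ 0), σ(V_j : j ≥ n))`. -/
def alphaProc {Ω H : Type*} [MeasurableSpace Ω] [MeasurableSpace H] (μ : Measure Ω)
    (V : ℤ → Ω → H) (n : ℕ) : ℝ :=
  alphaCoeff μ (sigmaLE V 0) (sigmaGE V (n : ℤ))

/-- The process `X` is stationary and ergodic: the shift on path space preserves the law of `X`
and is ergodic for it. -/
def StationaryErgodic {Ω H : Type*} [MeasurableSpace Ω] [MeasurableSpace H] (μ : Measure Ω)
    (X : ℤ → Ω → H) : Prop :=
  Ergodic (fun (x : ℤ → H) (t : ℤ) => x (t + 1)) (μ.map fun ω t => X t ω)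

/-- The past `V_t^- = (V_{t-j})_{j ≥ 0}` of a process, at the sample point `ω`. -/
def past {Ω H : Type*} (V : ℤ → Ω → H) (t : ℤ) (ω : Ω) : ℕ → H :=
  fun j => V (t - (j : ℤ)) ω

/-- Total variation distance of two probability measures on a countable set. -/
def dTV {E : Type*} [MeasurableSpace E] (μ ν : Measure E) : ℝ :=
  (1 / 2) * ∑' y : E, |μ.real {y} - ν.real {y}|

section Model

variable {E F : Type*} [MeasurableSpace E] [MeasurableSpace F] {D : Set (ℕ → F)}

/-- `ℙ(Y_t = y | Y_{t-1}^-, X_{t-1}^-) = P(y | Y_{t-1}^-, X_{t-1}^-)` almost surely. -/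
def SolvesModel {Ω : Type*} [MeasurableSpace Ω] (μ : Measure Ω)
    (P : Kernel ((ℕ → E) × D) E) (X : ℤ → Ω → F) (Y : ℤ → Ω → E) : Prop :=
  ∀ (t : ℤ) (y : E), ∀ᵐ ω ∂μ, ∀ h : past X (t - 1) ω ∈ D,
    (μ[(Y t ⁻¹' {y}).indicator (fun _ => (1 : ℝ)) |
        sigmaLE Y (t - 1) ⊔ sigmaLE X (t - 1)]) ω
      = (P (past Y (t - 1) ω, ⟨past X (t - 1) ω, h⟩)).real {y}

/-- `ℙ(Y_t = y | Y_{t-1}^-, X_{t-1}^-) = ℙ(Y_t = y | Y_{t-1}^-, (X_s)_{s ∈ ℤ})` almost surely. -/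
def StrictlyExogenous {Ω : Type*} [MeasurableSpace Ω] (μ : Measure Ω)
    (X : ℤ → Ω → F) (Y : ℤ → Ω → E) : Prop :=
  ∀ (t : ℤ) (y : E),
    μ[(Y t ⁻¹' {y}).indicator (fun _ => (1 : ℝ)) | sigmaLE Y (t - 1) ⊔ sigmaLE X (t - 1)]
      =ᵐ[μ]
    μ[(Y t ⁻¹' {y}).indicator (fun _ => (1 : ℝ)) | sigmaLE Y (t - 1) ⊔ sigmaAll X]

/-- Uniform total variation contraction of the kernel. -/
def AssumptionA3 (P : Kernel ((ℕ → E) × D) E) : Prop :=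
  sSup {c : ℝ | ∃ (y y' : ℕ → E) (x : D), c = dTV (P (y, x)) (P (y', x))} < 1

open Classical in
/-- Lipschitz-type control of the kernel. The series on the right-hand side are taken
in `[0, ∞]`, the second one being possibly divergent. -/
def AssumptionA4 [NormedAddCommGroup F] (P : Kernel ((ℕ → E) × D) E) (a e : ℕ → ℝ) : Prop :=
  (∀ j, 0 ≤ a j) ∧ (∀ j, 0 ≤ e j) ∧ Summable (fun j : ℕ => (j : ℝ) * a j) ∧ Summable e ∧
  ∀ (y y' : ℕ → E) (x x' : D),
    ENNReal.ofReal (dTV (P (y, x)) (P (y', x'))) ≤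
      (∑' i : ℕ, if y i ≠ y' i then ENNReal.ofReal (a i) else 0)
        + ∑' j : ℕ, ENNReal.ofReal (e j * ‖x.1 j - x'.1 j‖)

/-- `b_m`: the largest total variation distance between the kernels started from two pasts that
agree on their `m` most recent coordinates. -/
def bCoeff (P : Kernel ((ℕ → E) × D) E) (m : ℕ) : ℝ :=
  sSup {c : ℝ | ∃ (y y' : ℕ → E) (x : D), (∀ j < m, y j = y' j) ∧
    c = dTV (P (y, x)) (P (y', x))}

end Model

/-- Transition matrix: `Q(i, i+1) = 1 - b_i` and `Q(i, 0) = b_i`. -/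
def renewalMatrix (b : ℕ → ℝ) (i j : ℕ) : ℝ :=
  if j = i + 1 then 1 - b i else if j = 0 then b i else 0

/-- `renewalLaw b n j = ℙ(T_n = j)` for the time-homogeneous Markov chain `T` on `ℕ` with
transition matrix `renewalMatrix b` and `T_0 = 0`. (The sum has finitely many nonzero terms.) -/
def renewalLaw (b : ℕ → ℝ) : ℕ → ℕ → ℝ
  | 0, j => if j = 0 then 1 else 0
  | n + 1, j => ∑' i : ℕ, renewalLaw b n i * renewalMatrix b i j

/-- `b*_0 = b_0` and `b*_n = ℙ(T_n = 0)` for `n ≥ 1`. -/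
def bStar (b : ℕ → ℝ) (n : ℕ) : ℝ :=
  if n = 0 then b 0 else renewalLaw b n 0

/-- `S_j = ∑_{t ≥ j} e_t`. -/
def tailSum (e : ℕ → ℝ) (j : ℕ) : ℝ :=
  ∑' t : Set.Ici j, e t

/-- `(u * v)_n = ∑_{j=0}^n u_j v_{n-j}`. -/
def conv (u v : ℕ → ℝ) (n : ℕ) : ℝ :=
  ∑ j ∈ Finset.range (n + 1), u j * v (n - j)

end InfiniteMemory

end

/-! By strict exogeneity the kernel is also the conditional law of `Y_t` given the past of `Y` and
the whole path of `X`. The conditional probability of a finite-window event is therefore found by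
integrating the values of `Y` out one at a time, backwards (`lintegral_mul_iterBack`). Two such
computations, started from different pasts and covariate paths, are compared by maximal coupling. An
agreement of length m grows to m + 1 unless the two draws differ, which has probability at most b_m
plus an effect of the covariates; otherwise it drops to 0. So the agreement length is controlled by
the chain T, and a window of length M costs ℙ(T_k < M) plus covariate terms (`iterBack_le_add`).

In the future event, `X` is averaged over a copy drawn conditionally on X_j, j ≥ r. The copy agrees
with `X` from r on, so only lags reaching before r contribute, with total weight S_j
(`exists_future_approximation`). The event becomes a function of X_j, j ≥ r, at L¹ cost d. In the
past event, integrating back far enough gives a function of X_j, j ≤ 0, with vanishing error, since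
b* may be assumed summable (`exists_past_approximation`). The covariance that remains, between two
[0,1]-valued functions of `X`, is at most α_X(r) (`abs_crossCov_le_alphaCoeff`). Renewal estimates
turn d into the stated series uniformly in the windows, and window events approximate all events. -/

noncomputable section

namespace InfiniteMemory

open scoped ENNReal Topology

/-! ### Total variation and maximal coupling on a countable set. -/

section TotalVariation

variable {E : Type*} [Countable E] [MeasurableSpace E] [MeasurableSingletonClass E]

lemma hasSum_real_singleton (μ : Measure E) [IsProbabilityMeasure μ] :
    HasSum (fun z => μ.real {z}) 1 := by
  have h : ∑' z, μ {z} = 1 := by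
    have := lintegral_countable' (μ := μ) (fun _ => (1 : ℝ≥0∞))
    simpa using this.symm
  have h2 := ENNReal.hasSum_toReal (f := fun z => μ {z}) (by rw [h]; simp)
  rw [← ENNReal.tsum_toReal_eq (fun z => measure_ne_top _ _), h] at h2
  simpa [Measure.real] using h2

lemma summable_abs_sub (μ ν : Measure E) [IsProbabilityMeasure μ] [IsProbabilityMeasure ν] :
    Summable (fun z => |μ.real {z} - ν.real {z}|) :=
  ((hasSum_real_singleton μ).summable.sub (hasSum_real_singleton ν).summable).abs

omit [Countable E] [MeasurableSingletonClass E] in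
lemma dTV_nonneg (μ ν : Measure E) : 0 ≤ dTV μ ν := by
  unfold dTV
  have : 0 ≤ ∑' z : E, |μ.real {z} - ν.real {z}| := tsum_nonneg fun z => abs_nonneg _
  linarith

lemma dTV_triangle (μ ν ρ : Measure E) [IsProbabilityMeasure μ] [IsProbabilityMeasure ν]
    [IsProbabilityMeasure ρ] : dTV μ ρ ≤ dTV μ ν + dTV ν ρ := by
  unfold dTV
  rw [← mul_add, ← (summable_abs_sub μ ν).tsum_add (summable_abs_sub ν ρ)]
  refine mul_le_mul_of_nonneg_left ?_ (by norm_num)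
  exact (summable_abs_sub μ ρ).tsum_le_tsum (fun z => abs_sub_le _ _ _)
    ((summable_abs_sub μ ν).add (summable_abs_sub ν ρ))

lemma hasSum_min (μ ν : Measure E) [IsProbabilityMeasure μ] [IsProbabilityMeasure ν] :
    HasSum (fun z => min (μ.real {z}) (ν.real {z})) (1 - dTV μ ν) := by
  have h := (((hasSum_real_singleton μ).add (hasSum_real_singleton ν)).sub
    (summable_abs_sub μ ν).hasSum).mul_left (1 / 2)
  convert! h using 1
  · funext z
    rcases le_total (μ.real {z}) (ν.real {z}) with h | h
    · rw [min_eq_left h, abs_of_nonpos (by linarith)]; ring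
    · rw [min_eq_right h, abs_of_nonneg (by linarith)]; ring
  · unfold dTV; ring

lemma dTV_le_one (μ ν : Measure E) [IsProbabilityMeasure μ] [IsProbabilityMeasure ν] :
    dTV μ ν ≤ 1 := by
  have := (hasSum_min μ ν).nonneg (fun z => le_min measureReal_nonneg measureReal_nonneg)
  linarith

/-- The maximal coupling of `P` and `Q`, at the level of expectations. -/
lemma lintegral_le_lintegral_add_dTV (P Q : Measure E) [IsProbabilityMeasure P]
    [IsProbabilityMeasure Q] (f g : E → ℝ≥0∞) (u v : ℝ≥0∞)
    (hu : ∀ z, f z ≤ g z + u) (hv : ∀ z z', f z ≤ g z' + v) :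
    ∫⁻ z, f z ∂P ≤ ∫⁻ z, g z ∂Q + (ENNReal.ofReal (1 - dTV P Q) * u
      + ENNReal.ofReal (dTV P Q) * v) := by
  set c : E → ℝ := fun z => min (P.real {z}) (Q.real {z}) with hc
  have hc0 : ∀ z, 0 ≤ c z := fun z => le_min measureReal_nonneg measureReal_nonneg
  have hsum : ∑' z, ENNReal.ofReal (c z) = ENNReal.ofReal (1 - dTV P Q) := by
    rw [← ENNReal.ofReal_tsum_of_nonneg hc0 (hasSum_min P Q).summable, (hasSum_min P Q).tsum_eq]
  have key : ∀ (R : Measure E) [IsProbabilityMeasure R], (∀ z, c z ≤ R.real {z}) →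
      (∀ z, R {z} = ENNReal.ofReal (c z) + ENNReal.ofReal (R.real {z} - c z)) ∧
      ∑' z, ENNReal.ofReal (R.real {z} - c z) = ENNReal.ofReal (dTV P Q) := by
    intro R _ hR
    refine ⟨fun z => ?_, ?_⟩
    · rw [← ENNReal.ofReal_add (hc0 z) (by linarith [hR z])]
      simp [Measure.real]
    · have h := (hasSum_real_singleton R).sub (hasSum_min P Q)
      rw [← ENNReal.ofReal_tsum_of_nonneg (fun z => by linarith [hR z]) h.summable, h.tsum_eq]
      congr 1; ring
  obtain ⟨hP1, hP2⟩ := key P (fun z => min_le_left _ _)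
  obtain ⟨hQ1, hQ2⟩ := key Q (fun z => min_le_right _ _)
  rw [lintegral_countable', lintegral_countable']
  simp_rw [hP1, hQ1, mul_add]
  rw [ENNReal.tsum_add, ENNReal.tsum_add]
  -- On the common part of the two laws both copies take the same value, so `u` applies.
  have h1 : ∑' z, f z * ENNReal.ofReal (c z) ≤
      ∑' z, g z * ENNReal.ofReal (c z) + ENNReal.ofReal (1 - dTV P Q) * u := by
    rw [← hsum, ← ENNReal.tsum_mul_right, ← ENNReal.tsum_add]
    refine ENNReal.tsum_le_tsum fun z => ?_
    calc f z * ENNReal.ofReal (c z) ≤ (g z + u) * ENNReal.ofReal (c z) := by gcongr; exact hu z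
      _ = _ := by ring
  -- The excess masses of `P` and `Q` over the common part have the same total `dTV P Q`. Comparing
  -- both sides with `⨅ z', g z'` avoids constructing a coupling of them.
  have h2 : ∑' z, f z * ENNReal.ofReal (P.real {z} - c z) ≤
      ∑' z, g z * ENNReal.ofReal (Q.real {z} - c z) + ENNReal.ofReal (dTV P Q) * v := by
    calc ∑' z, f z * ENNReal.ofReal (P.real {z} - c z)
        ≤ ∑' z, ((⨅ z', g z') + v) * ENNReal.ofReal (P.real {z} - c z) := by
          refine ENNReal.tsum_le_tsum fun z => ?_
          gcongr
          rw [ENNReal.iInf_add]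
          exact le_iInf (hv z)
      _ = (⨅ z', g z') * ENNReal.ofReal (dTV P Q) + ENNReal.ofReal (dTV P Q) * v := by
          rw [ENNReal.tsum_mul_left, hP2]; ring
      _ ≤ _ := by
          gcongr
          rw [← hQ2, ← ENNReal.tsum_mul_left]
          refine ENNReal.tsum_le_tsum fun z => ?_
          gcongr
          exact iInf_le _ _
  calc _ ≤ _ := add_le_add h1 h2
    _ = _ := by ring

end TotalVariation

/-! ### The renewal chain of agreement lengths. -/

section Renewal

variable {b : ℕ → ℝ}

/-- Backward evolution of the function `1_{· < M}` under the chain `renewalMatrix b`. -/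
def renewalValue (b : ℕ → ℝ) (φ : ℕ → ℝ) : ℕ → ℕ → ℝ
  | 0, m => φ m
  | k + 1, m => (1 - b m) * renewalValue b φ k (m + 1) + b m * renewalValue b φ k 0

/-- The indicator of `{m | m < M}`. -/
def ltIndicator (M m : ℕ) : ℝ := if m < M then 1 else 0

lemma renewalLaw_eq_zero (n j : ℕ) (h : n < j) : renewalLaw b n j = 0 := by
  induction n generalizing j with
  | zero => simp [renewalLaw]; omega
  | succ n ih =>
    rw [renewalLaw]
    convert tsum_zero with i
    rcases lt_or_ge n i with hi | hi
    · rw [ih i hi, zero_mul]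
    · rw [renewalMatrix, if_neg (by omega), if_neg (by omega), mul_zero]

lemma renewalLaw_succ_succ (n j : ℕ) :
    renewalLaw b (n + 1) (j + 1) = renewalLaw b n j * (1 - b j) := by
  rw [renewalLaw, tsum_eq_single j]
  · simp [renewalMatrix]
  · intro i hi
    rw [renewalMatrix, if_neg (by omega), if_neg (by omega), mul_zero]

lemma renewalLaw_succ_zero (n : ℕ) :
    renewalLaw b (n + 1) 0 = ∑ i ∈ Finset.range (n + 1), renewalLaw b n i * b i := by
  rw [renewalLaw, tsum_eq_sum (s := Finset.range (n + 1))]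
  · simp [renewalMatrix]
  · intro i hi
    rw [renewalLaw_eq_zero n i (by simpa using hi), zero_mul]

lemma renewalLaw_nonneg (hb0 : ∀ m, 0 ≤ b m) (hb1 : ∀ m, b m ≤ 1) (n j : ℕ) :
    0 ≤ renewalLaw b n j := by
  induction n generalizing j with
  | zero => simp only [renewalLaw]; split_ifs <;> simp
  | succ n ih =>
    cases j with
    | zero =>
      rw [renewalLaw_succ_zero]
      exact Finset.sum_nonneg fun i _ => mul_nonneg (ih i) (hb0 i)
    | succ j =>
      rw [renewalLaw_succ_succ]
      exact mul_nonneg (ih j) (by linarith [hb1 j])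

lemma bStar_nonneg (hb0 : ∀ m, 0 ≤ b m) (hb1 : ∀ m, b m ≤ 1) (n : ℕ) : 0 ≤ bStar b n := by
  unfold bStar
  split_ifs
  · exact hb0 0
  · exact renewalLaw_nonneg hb0 hb1 n 0

lemma renewalValue_succ' (φ : ℕ → ℝ) (k m : ℕ) : renewalValue b φ (k + 1) m =
    renewalValue b (fun m => (1 - b m) * φ (m + 1) + b m * φ 0) k m := by
  induction k generalizing m with
  | zero => rfl
  | succ k ih => rw [renewalValue, ih, ih]; rfl

lemma renewalValue_zero_eq_sum (φ : ℕ → ℝ) (k : ℕ) :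
    renewalValue b φ k 0 = ∑ j ∈ Finset.range (k + 1), renewalLaw b k j * φ j := by
  induction k generalizing φ with
  | zero => simp [renewalValue, renewalLaw]
  | succ k ih =>
    rw [renewalValue_succ', ih, Finset.sum_range_succ' _ (k + 1), renewalLaw_succ_zero,
      Finset.sum_mul, ← Finset.sum_add_distrib]
    refine Finset.sum_congr rfl fun j _ => ?_
    rw [renewalLaw_succ_succ]; ring

lemma renewalValue_nonneg {φ : ℕ → ℝ} (hb0 : ∀ m, 0 ≤ b m) (hb1 : ∀ m, b m ≤ 1)
    (hφ : ∀ m, 0 ≤ φ m) (k m : ℕ) : 0 ≤ renewalValue b φ k m := by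
  induction k generalizing m with
  | zero => exact hφ m
  | succ k ih =>
    exact add_nonneg (mul_nonneg (by linarith [hb1 m]) (ih _)) (mul_nonneg (hb0 m) (ih _))

lemma renewalValue_le_one {φ : ℕ → ℝ} (hb0 : ∀ m, 0 ≤ b m) (hb1 : ∀ m, b m ≤ 1)
    (hφ : ∀ m, φ m ≤ 1) (k m : ℕ) : renewalValue b φ k m ≤ 1 := by
  induction k generalizing m with
  | zero => exact hφ m
  | succ k ih =>
    rw [renewalValue]
    nlinarith [ih (m + 1), ih 0, hb0 m, hb1 m]

/-- A longer agreement is less likely to be broken and worth more when kept. This monotonicity lets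
an upper bound on the breaking probability be substituted for its exact value. -/
lemma renewalValue_antitone {φ : ℕ → ℝ} (hb1 : ∀ m, b m ≤ 1)
    (hb : Antitone b) (hφ : Antitone φ) (k : ℕ) : Antitone (renewalValue b φ k) := by
  induction k with
  | zero => exact hφ
  | succ k ih =>
    refine antitone_nat_of_succ_le fun m => ?_
    rw [renewalValue, renewalValue]
    -- With w the value at stage k, the difference is (1 - b_{m+1})(w_{m+1} - w_{m+2}) + (b_m -
    -- b_{m+1})(w_0 - w_{m+1}).
    nlinarith [ih (Nat.le_succ (m + 1)), ih (Nat.zero_le (m + 1)), hb (Nat.le_succ m),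
      hb1 (m + 1), hb1 m, mul_nonneg (sub_nonneg.2 (hb (Nat.le_succ m)))
        (sub_nonneg.2 (ih (Nat.zero_le (m + 1)))),
      mul_nonneg (sub_nonneg.2 (hb1 (m + 1))) (sub_nonneg.2 (ih (Nat.le_succ (m + 1))))]

/-- The chain can be at j at time n + j only by having been at 0 at time n and climbed ever since.
-/
lemma renewalLaw_le (hb0 : ∀ m, 0 ≤ b m) (hb1 : ∀ m, b m ≤ 1) (n j : ℕ) :
    renewalLaw b (n + j) j ≤ renewalLaw b n 0 := by
  induction j with
  | zero => simp
  | succ j ih =>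
    rw [← add_assoc, renewalLaw_succ_succ]
    nlinarith [hb0 j, hb1 j, renewalLaw_nonneg hb0 hb1 (n + j) j]

lemma ltIndicator_nonneg (M m : ℕ) : 0 ≤ ltIndicator M m := by
  unfold ltIndicator; split_ifs <;> simp

lemma ltIndicator_le_one (M m : ℕ) : ltIndicator M m ≤ 1 := by
  unfold ltIndicator; split_ifs <;> simp

lemma ltIndicator_antitone (M : ℕ) : Antitone (ltIndicator M) := by
  intro i j hij
  unfold ltIndicator
  split_ifs <;> first | omega | simp

lemma renewalValue_ltIndicator_le (hb0 : ∀ m, 0 ≤ b m) (hb1 : ∀ m, b m ≤ 1) (M k : ℕ)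
    (hk : M ≤ k) :
    renewalValue b (ltIndicator M) k 0 ≤ ∑ j ∈ Finset.range M, bStar b (k - j) := by
  rw [renewalValue_zero_eq_sum]
  calc ∑ j ∈ Finset.range (k + 1), renewalLaw b k j * ltIndicator M j
      = ∑ j ∈ Finset.range M, renewalLaw b k j * ltIndicator M j := by
        symm
        refine Finset.sum_subset (by intro j; simp; omega) fun j _ hj => ?_
        rw [ltIndicator, if_neg (by simpa using hj), mul_zero]
    _ ≤ _ := by
        refine Finset.sum_le_sum fun j hj => ?_
        have hj' : j < M := by simpa using hj
        -- Since j < M ≤ k, the index k - j is positive and the convention for b*_0 plays no role.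
        rw [ltIndicator, if_pos hj', mul_one, bStar, if_neg (by omega)]
        have := renewalLaw_le hb0 hb1 (k - j) j
        rwa [Nat.sub_add_cancel (by omega)] at this

end Renewal

/-! ### Elementary properties of the coefficients b_m. -/

section Coefficients

variable {E F : Type*} [Countable E] [MeasurableSpace E] [MeasurableSingletonClass E]
  [MeasurableSpace F] {D : Set (ℕ → F)} (P : Kernel ((ℕ → E) × D) E) [IsMarkovKernel P]

lemma bddAbove_bCoeff (m : ℕ) : BddAbove {c : ℝ | ∃ (y y' : ℕ → E) (x : D),
    (∀ j < m, y j = y' j) ∧ c = dTV (P (y, x)) (P (y', x))} :=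
  ⟨1, by rintro c ⟨y, y', x, -, rfl⟩; exact dTV_le_one _ _⟩

lemma dTV_le_bCoeff {m : ℕ} {y y' : ℕ → E} (h : ∀ j < m, y j = y' j) (x : D) :
    dTV (P (y, x)) (P (y', x)) ≤ bCoeff P m :=
  le_csSup (bddAbove_bCoeff P m) ⟨y, y', x, h, rfl⟩

omit [Countable E] [MeasurableSingletonClass E] [IsMarkovKernel P] in
lemma bCoeff_nonneg (m : ℕ) : 0 ≤ bCoeff P m :=
  Real.sSup_nonneg (by rintro c ⟨y, y', x, -, rfl⟩; exact dTV_nonneg _ _)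

lemma bCoeff_le_one (m : ℕ) : bCoeff P m ≤ 1 :=
  Real.sSup_le (by rintro c ⟨y, y', x, -, rfl⟩; exact dTV_le_one _ _) zero_le_one

lemma bCoeff_antitone : Antitone (bCoeff P) := by
  intro i j hij
  refine Real.sSup_le ?_ (bCoeff_nonneg P i)
  rintro c ⟨y, y', x, h, rfl⟩
  exact dTV_le_bCoeff P (fun k hk => h k (by omega)) x

end Coefficients

/-! ### Backward integration of `Y` and the coupling estimate. -/

section Backward

/-- Put a new value in front of a sequence. -/
def consSeq {E : Type*} (z : E) (y : ℕ → E) : ℕ → E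
  | 0 => z
  | n + 1 => y n

/-- The past of a two-sided path. -/
def pathPast {F : Type*} (x : ℤ → F) (t : ℤ) : ℕ → F := fun j => x (t - (j : ℤ))

lemma measurable_consSeq {E : Type*} [MeasurableSpace E] :
    Measurable (fun p : E × (ℕ → E) => consSeq p.1 p.2) := by
  refine measurable_pi_lambda _ fun n => ?_
  cases n with
  | zero => exact measurable_fst
  | succ n => exact (measurable_pi_apply n).comp measurable_snd

lemma measurable_pathPast {F : Type*} [MeasurableSpace F] (t : ℤ) :
    Measurable (fun x : ℤ → F => pathPast x t) :=
  measurable_pi_lambda _ fun _ => measurable_pi_apply _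

variable {E F : Type*} [MeasurableSpace E] [MeasurableSpace F] {D : Set (ℕ → F)}

/-- Integrate out the value of `Y` at time `t`: conditional expectation of
`ψ (Y_t^-, X)` given `Y_{t-1}^- = y` and `X = x`. -/
def stepBack (P : Kernel ((ℕ → E) × D) E) (ρ : (ℕ → F) → D) (t : ℤ)
    (ψ : (ℕ → E) × (ℤ → F) → ℝ≥0∞) (p : (ℕ → E) × (ℤ → F)) : ℝ≥0∞ :=
  ∫⁻ z, ψ (consSeq z p.1, p.2) ∂P (p.1, ρ (pathPast p.2 (t - 1)))

/-- Integrate out the values of `Y` at the times `N, N - 1, …, N - k + 1`. -/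
def iterBack (P : Kernel ((ℕ → E) × D) E) (ρ : (ℕ → F) → D) (N : ℤ)
    (ψ : (ℕ → E) × (ℤ → F) → ℝ≥0∞) : ℕ → (ℕ → E) × (ℤ → F) → ℝ≥0∞
  | 0 => ψ
  | k + 1 => stepBack P ρ (N - k) (iterBack P ρ N ψ k)

variable {P : Kernel ((ℕ → E) × D) E} {ρ : (ℕ → F) → D} {N : ℤ}
  {ψ : (ℕ → E) × (ℤ → F) → ℝ≥0∞}

lemma measurable_stepBack [IsSFiniteKernel P] (hρ : Measurable ρ) (hψ : Measurable ψ) (t : ℤ) :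
    Measurable (stepBack P ρ t ψ) := by
  have hg : Measurable (fun p : (ℕ → E) × (ℤ → F) => (p.1, ρ (pathPast p.2 (t - 1)))) :=
    measurable_fst.prodMk (hρ.comp ((measurable_pathPast _).comp measurable_snd))
  have := Measurable.lintegral_kernel_prod_right (κ := P.comap _ hg)
    (f := fun p z => ψ (consSeq z p.1, p.2))
    (hψ.comp ((measurable_consSeq.comp (measurable_snd.prodMk (measurable_fst.comp
      measurable_fst))).prodMk (measurable_snd.comp measurable_fst)))
  simp only [Kernel.comap_apply] at this
  exact this

lemma measurable_iterBack [IsSFiniteKernel P] (hρ : Measurable ρ) (hψ : Measurable ψ) (k : ℕ) :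
    Measurable (iterBack P ρ N ψ k) := by
  induction k with
  | zero => exact hψ
  | succ k ih => exact measurable_stepBack hρ ih _

lemma iterBack_le_one [IsMarkovKernel P] (hψ : ∀ p, ψ p ≤ 1) (k : ℕ) (p : (ℕ → E) × (ℤ → F)) :
    iterBack P ρ N ψ k p ≤ 1 := by
  induction k generalizing p with
  | zero => exact hψ p
  | succ k ih =>
    calc iterBack P ρ N ψ (k + 1) p ≤ ∫⁻ _, 1 ∂P (p.1, ρ (pathPast p.2 (N - k - 1))) :=
          lintegral_mono fun z => ih _
      _ = 1 := by simp

/-- The kernels involved only see covariates before time `N`; this is what makes the approximation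
of a past event adapted to the past of `X`. -/
lemma iterBack_congr_path {x x' : ℤ → F} (hψ : ∀ y, ψ (y, x) = ψ (y, x'))
    (hx : ∀ j ≤ N, x j = x' j) (k : ℕ) (y : ℕ → E) :
    iterBack P ρ N ψ k (y, x) = iterBack P ρ N ψ k (y, x') := by
  induction k generalizing y with
  | zero => exact hψ y
  | succ k ih =>
    have : pathPast x (N - k - 1) = pathPast x' (N - k - 1) :=
      funext fun j => hx _ (by omega)
    simp only [iterBack, stepBack, ih, this]

/-- The two evolutions are coupled step by step. The first error term is the probability that the
chain, started from agreement length `m`, ends below `M`. Each summand is the chance that the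
covariates cause an additional break when `i` steps remain, times the cost of restarting from 0. -/
lemma iterBack_le_add [Countable E] [MeasurableSingletonClass E] [IsMarkovKernel P]
    {x x' : ℤ → F} {M : ℕ} (hψ1 : ∀ p, ψ p ≤ 1)
    (hψ : ∀ y y', (∀ j < M, y j = y' j) → ψ (y, x) ≤ ψ (y', x'))
    (δ : ℤ → ℝ≥0∞)
    (hδ : ∀ t y, ENNReal.ofReal (dTV (P (y, ρ (pathPast x (t - 1))))
      (P (y, ρ (pathPast x' (t - 1))))) ≤ δ t)
    (k m : ℕ) (y y' : ℕ → E) (hy : ∀ j < m, y j = y' j) :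
    iterBack P ρ N ψ k (y, x) ≤ iterBack P ρ N ψ k (y', x') +
      (ENNReal.ofReal (renewalValue (bCoeff P) (ltIndicator M) k m) +
        ∑ i ∈ Finset.range k, δ (N - i) *
          ENNReal.ofReal (renewalValue (bCoeff P) (ltIndicator M) i 0)) := by
  have hb0 := bCoeff_nonneg P
  have hb1 := bCoeff_le_one P
  set W := renewalValue (bCoeff P) (ltIndicator M) with hW
  have hW0 : ∀ k m, 0 ≤ W k m := renewalValue_nonneg hb0 hb1 (ltIndicator_nonneg M)
  induction k generalizing m y y' with
  | zero =>
    simp only [Finset.range_zero, Finset.sum_empty, add_zero, iterBack]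
    rcases le_or_gt M m with h | h
    · exact (hψ y y' fun j hj => hy j (by omega)).trans le_self_add
    · refine (hψ1 _).trans ?_
      simp [hW, renewalValue, ltIndicator, h]
  | succ k ih =>
    set R := ∑ i ∈ Finset.range k, δ (N - i) * ENNReal.ofReal (W i 0)
    set Q := P (y, ρ (pathPast x (N - k - 1)))
    set Q' := P (y', ρ (pathPast x' (N - k - 1)))
    set b := bCoeff P m
    have hp0 : 0 ≤ dTV Q Q' := dTV_nonneg _ _
    have hp1 : dTV Q Q' ≤ 1 := dTV_le_one _ _
    -- Triangle inequality through the kernel at `(y', x)`: changing the past costs `b`, changing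
    -- the path costs `δ`.
    have hpd : ENNReal.ofReal (max (dTV Q Q' - b) 0) ≤ δ (N - k) := by
      refine le_trans (ENNReal.ofReal_le_ofReal ?_) (hδ (N - k) y')
      refine max_le ?_ (dTV_nonneg _ _)
      have h1 := dTV_triangle Q (P (y', ρ (pathPast x (N - k - 1)))) Q'
      have h2 := dTV_le_bCoeff P hy (ρ (pathPast x (N - k - 1)))
      linarith
    have step := lintegral_le_lintegral_add_dTV Q Q'
      (fun z => iterBack P ρ N ψ k (consSeq z y, x))
      (fun z => iterBack P ρ N ψ k (consSeq z y', x'))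
      (ENNReal.ofReal (W k (m + 1)) + R) (ENNReal.ofReal (W k 0) + R)
      -- Equal draws lengthen the agreement by one; arbitrary draws guarantee only length 0.
      (fun z => ih (m + 1) _ _ (by
        intro j hj
        cases j with
        | zero => rfl
        | succ j => exact hy j (by omega)))
      (fun z z' => ih 0 _ _ (by simp))
    refine step.trans (add_le_add le_rfl ?_)
    rw [Finset.sum_range_succ]
    have hsum : ENNReal.ofReal (1 - dTV Q Q') + ENNReal.ofReal (dTV Q Q') = 1 := by
      rw [← ENNReal.ofReal_add (by linarith) hp0]; simp
    calc ENNReal.ofReal (1 - dTV Q Q') * (ENNReal.ofReal (W k (m + 1)) + R)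
          + ENNReal.ofReal (dTV Q Q') * (ENNReal.ofReal (W k 0) + R)
        = ENNReal.ofReal ((1 - dTV Q Q') * W k (m + 1) + dTV Q Q' * W k 0)
          + (ENNReal.ofReal (1 - dTV Q Q') + ENNReal.ofReal (dTV Q Q')) * R := by
          rw [ENNReal.ofReal_add (mul_nonneg (by linarith) (hW0 _ _)) (mul_nonneg hp0 (hW0 _ _)),
            ENNReal.ofReal_mul (by linarith), ENNReal.ofReal_mul hp0]
          ring
      _ ≤ ENNReal.ofReal (W (k + 1) m + max (dTV Q Q' - b) 0 * W k 0) + R := by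
          rw [hsum, one_mul]
          refine add_le_add (ENNReal.ofReal_le_ofReal ?_) le_rfl
          -- As a restart is the worse outcome, the breaking probability may be raised to `b`; any
          -- excess over `b` is charged at most `W k 0`.
          have hanti : W k (m + 1) ≤ W k 0 := renewalValue_antitone hb1 (bCoeff_antitone P)
            (ltIndicator_antitone M) k (Nat.zero_le _)
          have hWs : W (k + 1) m = (1 - b) * W k (m + 1) + b * W k 0 := rfl
          rw [hWs]
          rcases le_total (dTV Q Q' - b) 0 with h | h
          · rw [max_eq_right h]; nlinarith
          · rw [max_eq_left h]; nlinarith [hW0 k (m + 1)]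
      _ ≤ ENNReal.ofReal (W (k + 1) m) + δ (N - k) * ENNReal.ofReal (W k 0) + R := by
          rw [ENNReal.ofReal_add (hW0 _ _) (mul_nonneg (le_max_right _ _) (hW0 _ _)),
            ENNReal.ofReal_mul (le_max_right _ _)]
          gcongr
      _ = _ := by ring

end Backward

/-! ### Consequences of stationarity of `X`. -/

section Stationarity

variable {Ω F : Type*} [MeasurableSpace Ω] [MeasurableSpace F] {μ : Measure Ω} {X : ℤ → Ω → F}

lemma measurable_path (hX : ∀ t, Measurable (X t)) : Measurable (fun ω t => X t ω) :=
  measurable_pi_lambda _ hX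

lemma measurable_past (hX : ∀ t, Measurable (X t)) (t : ℤ) : Measurable (past X t) :=
  measurable_pi_lambda _ fun _ => hX _

lemma measurable_pathShift (k : ℤ) : Measurable (fun (x : ℤ → F) (t : ℤ) => x (t + k)) :=
  measurable_pi_lambda _ fun _ => measurable_pi_apply _

lemma StationaryErgodic.lintegral_shift (h : StationaryErgodic μ X) (hX : ∀ t, Measurable (X t))
    (k : ℤ) {g : (ℤ → F) → ℝ≥0∞} (hg : Measurable g) :
    ∫⁻ ω, g (fun t => X (t + k) ω) ∂μ = ∫⁻ ω, g (fun t => X t ω) ∂μ := by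
  have one : ∀ g : (ℤ → F) → ℝ≥0∞, Measurable g →
      ∫⁻ ω, g (fun t => X (t + 1) ω) ∂μ = ∫⁻ ω, g (fun t => X t ω) ∂μ := by
    intro g hg
    have := h.toMeasurePreserving.lintegral_comp hg
    rwa [lintegral_map hg (measurable_path hX),
      lintegral_map (f := fun x : ℤ → F => g fun t => x (t + 1))
        (hg.comp (measurable_pathShift 1)) (measurable_path hX)] at this
  induction k using Int.induction_on generalizing g with
  | zero => simp
  | succ i ih =>
    have := ih (hg.comp (measurable_pathShift 1))
    simp only [Function.comp_def] at this
    rw [one g hg] at this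
    rw [← this]
    congr! 5
    omega
  | pred i ih =>
    have h1 := ih (hg.comp (measurable_pathShift (-1)))
    have h2 := one _ (hg.comp (measurable_pathShift (-1)))
    simp only [Function.comp_def] at h1 h2
    rw [← h2] at h1
    simp only [neg_add_cancel_right] at h1
    rw [← h1]
    congr! 5
    omega

lemma StationaryErgodic.ae_past_mem (h : StationaryErgodic μ X) (hX : ∀ t, Measurable (X t))
    {D : Set (ℕ → F)} (hD : MeasurableSet D) (hXD : ∀ᵐ ω ∂μ, past X (-1) ω ∈ D) :
    ∀ᵐ ω ∂μ, ∀ t, past X t ω ∈ D := by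
  rw [ae_all_iff]
  intro t
  have hS : MeasurableSet {x : ℤ → F | pathPast x (-1) ∈ Dᶜ} := measurable_pathPast (-1) hD.compl
  have hg : Measurable ({x : ℤ → F | pathPast x (-1) ∈ Dᶜ}.indicator (1 : (ℤ → F) → ℝ≥0∞)) :=
    measurable_one.indicator hS
  have h1 := h.lintegral_shift hX (t + 1) hg
  rw [lintegral_eq_zero_of_ae_eq_zero (hXD.mono fun ω hω => Set.indicator_of_notMem (a := fun s => X s ω)
      (s := {x : ℤ → F | pathPast x (-1) ∈ Dᶜ}) (fun hn => hn hω) _)] at h1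
  have h2 := (lintegral_eq_zero_iff
    (hg.comp (measurable_path (X := fun s => X (s + (t + 1))) fun s => hX _))).1 h1
  filter_upwards [h2] with ω hω
  by_contra hn
  have hmem : (fun s => X (s + (t + 1)) ω) ∈ {x : ℤ → F | pathPast x (-1) ∈ Dᶜ} := by
    have : pathPast (fun s => X (s + (t + 1)) ω) (-1) = past X t ω := by
      funext j
      simp only [pathPast, past]
      congr 1
      omega
    simpa [this] using hn
  simp only [Function.comp_apply, Pi.zero_apply, Set.indicator_apply_eq_zero] at hω
  exact one_ne_zero (hω hmem)

lemma StationaryErgodic.lintegral_enorm {F : Type*} [NormedAddCommGroup F] [MeasurableSpace F]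
    [BorelSpace F] {X : ℤ → Ω → F} (h : StationaryErgodic μ X) (hX : ∀ t, Measurable (X t))
    (t : ℤ) : ∫⁻ ω, ‖X t ω‖ₑ ∂μ = ∫⁻ ω, ‖X 0 ω‖ₑ ∂μ := by
  have := h.lintegral_shift hX t (g := fun x => ‖x 0‖ₑ) (measurable_pi_apply 0).enorm
  simpa using this

end Stationarity

/-! ### Conditional laws of `Y` given its past and the whole path of `X`. -/

section Markov

variable {Ω E F : Type*} [MeasurableSpace Ω] [MeasurableSpace E] [MeasurableSpace F]
  {D : Set (ℕ → F)} {μ : Measure Ω} {X : ℤ → Ω → F} {Y : ℤ → Ω → E}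

/-- The kernel accepts only covariate pasts in `D`; composing with `ρ` makes it usable along every
path. -/
lemma exists_measurable_retraction (hD : MeasurableSet D) (hne : D.Nonempty) :
    ∃ ρ : (ℕ → F) → D, Measurable ρ ∧ ∀ x ∈ D, (ρ x : ℕ → F) = x := by
  classical
  obtain ⟨d, hd⟩ := hne
  refine ⟨fun x => ⟨if x ∈ D then x else d, by split_ifs <;> assumption⟩, ?_, ?_⟩
  · exact (Measurable.ite hD measurable_id measurable_const).subtype_mk
  · intro x hx; simp [hx]

omit [MeasurableSpace Ω] in
lemma measurable_sigmaLE (Y : ℤ → Ω → E) {s t : ℤ} (h : s ≤ t) : Measurable[sigmaLE Y t] (Y s) :=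
  Measurable.of_comap_le (le_iSup₂_of_le s h le_rfl)

omit [MeasurableSpace Ω] in
lemma measurable_sigmaGE (Y : ℤ → Ω → E) {s t : ℤ} (h : t ≤ s) : Measurable[sigmaGE Y t] (Y s) :=
  Measurable.of_comap_le (le_iSup₂_of_le s h le_rfl)

omit [MeasurableSpace Ω] in
lemma measurable_sigmaAll (X : ℤ → Ω → F) (s : ℤ) : Measurable[sigmaAll X] (X s) :=
  Measurable.of_comap_le (le_iSup_of_le s le_rfl)

lemma sigmaLE_le (hY : ∀ t, Measurable (Y t)) (t : ℤ) :
    sigmaLE Y t ≤ (inferInstance : MeasurableSpace Ω) :=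
  iSup₂_le fun s _ => (hY s).comap_le

lemma sigmaGE_le (hY : ∀ t, Measurable (Y t)) (t : ℤ) :
    sigmaGE Y t ≤ (inferInstance : MeasurableSpace Ω) :=
  iSup₂_le fun s _ => (hY s).comap_le

lemma sigmaAll_le (hY : ∀ t, Measurable (Y t)) :
    sigmaAll Y ≤ (inferInstance : MeasurableSpace Ω) :=
  iSup_le fun s => (hY s).comap_le

omit [MeasurableSpace Ω] in
lemma sigmaLE_mono (Y : ℤ → Ω → E) {s t : ℤ} (h : s ≤ t) : sigmaLE Y s ≤ sigmaLE Y t :=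
  iSup₂_le fun j hj => (measurable_sigmaLE Y (hj.trans h)).comap_le

/-- The σ-algebra generated by the past of `Y` up to time `t` and by the whole path of `X`. -/
@[reducible] def sigmaPastPath (Y : ℤ → Ω → E) (X : ℤ → Ω → F) (t : ℤ) : MeasurableSpace Ω :=
  sigmaLE Y t ⊔ sigmaAll X

lemma sigmaPastPath_le (hY : ∀ t, Measurable (Y t)) (hX : ∀ t, Measurable (X t)) (t : ℤ) :
    sigmaPastPath Y X t ≤ (inferInstance : MeasurableSpace Ω) :=
  sup_le (sigmaLE_le hY t) (sigmaAll_le hX)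

omit [MeasurableSpace Ω] in
lemma measurable_pastPath (Y : ℤ → Ω → E) (X : ℤ → Ω → F) (t : ℤ) :
    Measurable[sigmaPastPath Y X t] (fun ω => (past Y t ω, fun s => X s ω)) := by
  let _ : MeasurableSpace Ω := sigmaPastPath Y X t
  refine Measurable.prodMk ?_ ?_
  · refine measurable_pi_lambda _ fun _ => ?_
    exact (measurable_sigmaLE Y (by omega)).mono le_sup_left le_rfl
  · refine measurable_pi_lambda _ fun s => ?_
    exact (measurable_sigmaAll X s).mono le_sup_right le_rfl

variable [IsProbabilityMeasure μ] [Countable E] [MeasurableSingletonClass E]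
  {P : Kernel ((ℕ → E) × D) E} [IsMarkovKernel P] {ρ : (ℕ → F) → D}

omit [Countable E] in
-- Strict exogeneity is what allows `G` to depend on the future of `X` as well.
lemma setLIntegral_preimage_singleton (hX : ∀ t, Measurable (X t)) (hY : ∀ t, Measurable (Y t))
    (hXD : ∀ᵐ ω ∂μ, ∀ t, past X t ω ∈ D) (hρ : Measurable ρ)
    (hρD : ∀ x ∈ D, (ρ x : ℕ → F) = x)
    (hmodel : SolvesModel μ P X Y) (hexo : StrictlyExogenous μ X Y) (t : ℤ) (z : E)
    {G : Ω → ℝ≥0∞} (hG : Measurable[sigmaPastPath Y X (t - 1)] G) :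
    ∫⁻ ω in Y t ⁻¹' {z}, G ω ∂μ =
      ∫⁻ ω, P (past Y (t - 1) ω, ρ (past X (t - 1) ω)) {z} * G ω ∂μ := by
  have hm := sigmaPastPath_le hY hX (t - 1)
  set f : Ω → ℝ≥0∞ := fun ω => P (past Y (t - 1) ω, ρ (past X (t - 1) ω)) {z} with hf
  have hfm : Measurable f := (P.measurable_coe (measurableSet_singleton z)).comp
    ((measurable_past hY _).prodMk (hρ.comp (measurable_past hX _)))
  have hYz : MeasurableSet (Y t ⁻¹' {z}) := hY t (measurableSet_singleton z)
  have hf1 : ∀ ω, f ω ≤ 1 := fun ω => prob_le_one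
  have hcond : μ[(Y t ⁻¹' {z}).indicator (fun _ => (1 : ℝ)) | sigmaPastPath Y X (t - 1)]
      =ᵐ[μ] fun ω => (f ω).toReal := by
    filter_upwards [hexo t z, hmodel t z, hXD] with ω h1 h2 h3
    rw [← h1, h2 (h3 _)]
    have : ρ (past X (t - 1) ω) = ⟨past X (t - 1) ω, h3 _⟩ := Subtype.ext (hρD _ (h3 _))
    simp only [hf, this, Measure.real]
  -- The defining property of the conditional probability says that restricting `μ` to `{Y_t = z}`
  -- and giving it density `f` yield the same measure on the conditioning σ-algebra.
  have hset : ∀ C, MeasurableSet[sigmaPastPath Y X (t - 1)] C →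
      μ.restrict (Y t ⁻¹' {z}) C = μ.withDensity f C := by
    intro C hC
    rw [withDensity_apply _ (hm _ hC), Measure.restrict_apply (hm _ hC)]
    have h1 := setIntegral_condExp hm
      ((integrable_const (1 : ℝ)).indicator hYz : Integrable _ μ) hC
    rw [setIntegral_congr_ae (hm _ hC) (hcond.mono fun ω h _ => h),
      integral_toReal hfm.aemeasurable (ae_of_all _ fun ω => (hf1 ω).trans_lt (by simp)),
      integral_indicator_const _ hYz] at h1
    simp only [smul_eq_mul, mul_one, Measure.real, Measure.restrict_apply hYz] at h1
    have hfin : ∫⁻ ω in C, f ω ∂μ ≠ ∞ := by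
      refine ne_top_of_le_ne_top (b := 1) (by simp) ?_
      calc ∫⁻ ω in C, f ω ∂μ ≤ ∫⁻ ω in C, 1 ∂μ := lintegral_mono hf1
        _ ≤ 1 := by simpa using prob_le_one
    rw [Set.inter_comm]
    exact ((ENNReal.toReal_eq_toReal_iff' hfin (measure_ne_top _ _)).1 h1).symm
  have htrim : (μ.restrict (Y t ⁻¹' {z})).trim hm = (μ.withDensity f).trim hm := by
    refine @Measure.ext _ (sigmaPastPath Y X (t - 1)) _ _ fun C hC => ?_
    rw [trim_measurableSet_eq hm hC, trim_measurableSet_eq hm hC, hset C hC]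
  rw [← lintegral_trim hm hG, htrim, lintegral_trim hm hG,
    lintegral_withDensity_eq_lintegral_mul _ hfm (hG.mono hm le_rfl)]
  rfl

omit [MeasurableSpace Ω] [MeasurableSpace E] [Countable E] [MeasurableSingletonClass E] in
lemma past_eq_consSeq (Y : ℤ → Ω → E) (t : ℤ) (ω : Ω) :
    past Y t ω = consSeq (Y t ω) (past Y (t - 1) ω) := by
  funext j
  cases j with
  | zero => simp [past, consSeq]
  | succ j => simp only [past, consSeq]; congr 1; push_cast; ring

/-- Split over the countably many values z of `Y t`: on each piece the past up to t is z followed by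
the past up to t - 1, so the integrand is measurable for the conditioning σ-algebra. -/
lemma lintegral_mul_stepBack (hX : ∀ t, Measurable (X t)) (hY : ∀ t, Measurable (Y t))
    (hXD : ∀ᵐ ω ∂μ, ∀ t, past X t ω ∈ D) (hρ : Measurable ρ)
    (hρD : ∀ x ∈ D, (ρ x : ℕ → F) = x)
    (hmodel : SolvesModel μ P X Y) (hexo : StrictlyExogenous μ X Y) (t : ℤ)
    {ψ : (ℕ → E) × (ℤ → F) → ℝ≥0∞} (hψ : Measurable ψ)
    {G : Ω → ℝ≥0∞} (hG : Measurable[sigmaPastPath Y X (t - 1)] G) :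
    ∫⁻ ω, G ω * ψ (past Y t ω, fun s => X s ω) ∂μ =
      ∫⁻ ω, G ω * stepBack P ρ t ψ (past Y (t - 1) ω, fun s => X s ω) ∂μ := by
  have hm := sigmaPastPath_le hY hX (t - 1)
  have hGz : ∀ z, Measurable[sigmaPastPath Y X (t - 1)]
      (fun ω => G ω * ψ (consSeq z (past Y (t - 1) ω), fun s => X s ω)) := by
    intro z
    have h1 : Measurable (fun p : (ℕ → E) × (ℤ → F) => ψ (consSeq z p.1, p.2)) :=
      hψ.comp ((measurable_consSeq.comp (measurable_const.prodMk measurable_fst)).prodMk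
        measurable_snd)
    exact hG.mul (h1.comp (measurable_pastPath Y X (t - 1)))
  have hU : (⋃ z, Y t ⁻¹' {z}) = Set.univ := by ext ω; simp
  rw [← setLIntegral_univ, ← hU, lintegral_iUnion (fun z => hY t (measurableSet_singleton z))
    (by
      intro z z' hzz
      exact Disjoint.preimage _ (by simpa using hzz))]
  have h2 : ∀ z, ∫⁻ ω in Y t ⁻¹' {z}, G ω * ψ (past Y t ω, fun s => X s ω) ∂μ =
      ∫⁻ ω, P (past Y (t - 1) ω, ρ (past X (t - 1) ω)) {z} *
        (G ω * ψ (consSeq z (past Y (t - 1) ω), fun s => X s ω)) ∂μ := by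
    intro z
    rw [← setLIntegral_preimage_singleton hX hY hXD hρ hρD hmodel hexo t z (hGz z)]
    refine setLIntegral_congr_fun (hY t (measurableSet_singleton z)) fun ω hω => ?_
    simp only [Set.mem_preimage, Set.mem_singleton_iff] at hω
    rw [past_eq_consSeq Y t ω, hω]
  simp_rw [h2]
  rw [← lintegral_tsum]
  · refine lintegral_congr fun ω => ?_
    rw [stepBack, lintegral_countable', ← ENNReal.tsum_mul_left]
    refine tsum_congr fun z => ?_
    change _ = G ω * (_ * P (past Y (t - 1) ω, ρ (past X (t - 1) ω)) {z})
    ring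
  · intro z
    refine Measurable.aemeasurable (Measurable.mul ?_ ((hGz z).mono hm le_rfl))
    exact (P.measurable_coe (measurableSet_singleton z)).comp
      ((measurable_past hY _).prodMk (hρ.comp (measurable_past hX _)))

lemma lintegral_mul_iterBack (hX : ∀ t, Measurable (X t)) (hY : ∀ t, Measurable (Y t))
    (hXD : ∀ᵐ ω ∂μ, ∀ t, past X t ω ∈ D) (hρ : Measurable ρ)
    (hρD : ∀ x ∈ D, (ρ x : ℕ → F) = x)
    (hmodel : SolvesModel μ P X Y) (hexo : StrictlyExogenous μ X Y) (N : ℤ)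
    {ψ : (ℕ → E) × (ℤ → F) → ℝ≥0∞} (hψ : Measurable ψ) (k : ℕ)
    {G : Ω → ℝ≥0∞} (hG : Measurable[sigmaPastPath Y X (N - k)] G) :
    ∫⁻ ω, G ω * ψ (past Y N ω, fun s => X s ω) ∂μ =
      ∫⁻ ω, G ω * iterBack P ρ N ψ k (past Y (N - k) ω, fun s => X s ω) ∂μ := by
  induction k with
  | zero => simp [iterBack]
  | succ k ih =>
    have hk : N - (k + 1 : ℕ) = N - k - 1 := by push_cast; ring
    rw [hk] at hG ⊢
    rw [ih (hG.mono (sup_le_sup_right (sigmaLE_mono Y (by omega)) _) le_rfl),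
      lintegral_mul_stepBack hX hY hXD hρ hρD hmodel hexo (N - k)
        (measurable_iterBack hρ hψ k) hG]
    rfl

end Markov

/-! ### Covariances of [0,1]-valued functions and the mixing coefficient. -/

section Covariance

variable {Ω : Type*} {m m₁ m₂ m0 : MeasurableSpace Ω} {μ : Measure Ω}

/-- `E[f g] - E[f] E[g]`. -/
def crossCov (μ : Measure Ω) (f g : Ω → ℝ) : ℝ :=
  ∫ ω, f ω * g ω ∂μ - (∫ ω, f ω ∂μ) * ∫ ω, g ω ∂μ

lemma crossCov_comm (f g : Ω → ℝ) : crossCov μ f g = crossCov μ g f := by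
  simp only [crossCov, mul_comm]

variable [IsProbabilityMeasure μ]

lemma integrable_of_mem_Icc {f : Ω → ℝ} (hf : Measurable f) (h : ∀ ω, f ω ∈ Set.Icc 0 1) :
    Integrable f μ :=
  .of_bound hf.aestronglyMeasurable 1 (ae_of_all _ fun ω => by
    rw [Real.norm_of_nonneg (h ω).1]; exact (h ω).2)

lemma mul_mem_Icc {f g : Ω → ℝ} (hf : ∀ ω, f ω ∈ Set.Icc 0 1) (hg : ∀ ω, g ω ∈ Set.Icc 0 1)
    (ω : Ω) : f ω * g ω ∈ Set.Icc 0 1 :=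
  ⟨mul_nonneg (hf ω).1 (hg ω).1, mul_le_one₀ (hf ω).2 (hg ω).1 (hg ω).2⟩

/-- The factor 2 counts the expectation of the product and the product of expectations, each moving
by at most the L¹ distance. -/
lemma abs_crossCov_sub_le {f f' g : Ω → ℝ} (hf : Measurable f) (hf' : Measurable f')
    (hg : Measurable g) (h : ∀ ω, f ω ∈ Set.Icc 0 1) (h' : ∀ ω, f' ω ∈ Set.Icc 0 1)
    (hg1 : ∀ ω, g ω ∈ Set.Icc 0 1) :
    |crossCov μ f g - crossCov μ f' g| ≤ 2 * ∫ ω, |f ω - f' ω| ∂μ := by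
  have i1 := integrable_of_mem_Icc (μ := μ) hf h
  have i2 := integrable_of_mem_Icc (μ := μ) hf' h'
  have i3 := integrable_of_mem_Icc (μ := μ) hg hg1
  have i4 : Integrable (fun ω => f ω * g ω) μ := integrable_of_mem_Icc (hf.mul hg) (mul_mem_Icc h hg1)
  have i5 : Integrable (fun ω => f' ω * g ω) μ := integrable_of_mem_Icc (hf'.mul hg) (mul_mem_Icc h' hg1)
  have e : crossCov μ f g - crossCov μ f' g =
      ∫ ω, (f ω - f' ω) * g ω ∂μ - (∫ ω, (f ω - f' ω) ∂μ) * ∫ ω, g ω ∂μ := by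
    simp only [crossCov, sub_mul, integral_sub i1 i2]
    rw [integral_sub i4 i5]
    ring
  have b1 : |∫ ω, (f ω - f' ω) * g ω ∂μ| ≤ ∫ ω, |f ω - f' ω| ∂μ := by
    refine abs_integral_le_integral_abs.trans (integral_mono_of_nonneg
      (ae_of_all _ fun _ => abs_nonneg _) (i1.sub i2).abs (ae_of_all _ fun ω => ?_))
    simp only [abs_mul, abs_of_nonneg (hg1 ω).1]
    exact mul_le_of_le_one_right (abs_nonneg _) (hg1 ω).2
  have b2 : |∫ ω, (f ω - f' ω) ∂μ| ≤ ∫ ω, |f ω - f' ω| ∂μ := abs_integral_le_integral_abs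
  have g0 : 0 ≤ ∫ ω, g ω ∂μ := integral_nonneg fun ω => (hg1 ω).1
  have g1 : ∫ ω, g ω ∂μ ≤ 1 := by
    simpa using integral_mono i3 (integrable_const (1 : ℝ)) (fun ω => (hg1 ω).2)
  rw [e]
  refine (abs_sub _ _).trans ?_
  rw [abs_mul, abs_of_nonneg g0]
  nlinarith [abs_nonneg (∫ ω, (f ω - f' ω) ∂μ)]

/-- Among the `[0, 1]`-valued `m`-measurable functions, indicators have the largest covariances. -/
lemma exists_abs_crossCov_le_indicator (hm : m ≤ m0) {f g : Ω → ℝ}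
    (hf : Measurable[m] f) (hf1 : ∀ ω, f ω ∈ Set.Icc 0 1) (hg : Measurable g)
    (hg1 : ∀ ω, g ω ∈ Set.Icc 0 1) :
    ∃ C, MeasurableSet[m] C ∧ |crossCov μ f g| ≤ |crossCov μ (C.indicator 1) g| := by
  set k : Ω → ℝ := fun ω => g ω - ∫ ω, g ω ∂μ with hk
  have ig := integrable_of_mem_Icc (μ := μ) hg hg1
  have ik : Integrable k μ := ig.sub (integrable_const _)
  set ξ := μ[k | m]
  have iξ : Integrable ξ μ := integrable_condExp
  -- The covariance is the linear functional h ↦ E[hξ], with ξ the conditional expectation of the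
  -- centred `g`. It is largest at the indicator of {ξ > 0} and smallest at that of {ξ < 0}.
  have key : ∀ h : Ω → ℝ, Measurable[m] h → (∀ ω, h ω ∈ Set.Icc 0 1) →
      crossCov μ h g = ∫ ω, h ω * ξ ω ∂μ ∧ Integrable (fun ω => h ω * ξ ω) μ := by
    intro h hh h1
    have hb : ∀ᵐ ω ∂μ, ‖h ω‖ ≤ 1 := ae_of_all _ fun ω => by
      rw [Real.norm_of_nonneg (h1 ω).1]; exact (h1 ω).2
    have hh0 := hh.mono hm le_rfl
    have ih := integrable_of_mem_Icc (μ := μ) hh0 h1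
    have ihg : Integrable (fun ω => h ω * g ω) μ := integrable_of_mem_Icc (hh0.mul hg) (mul_mem_Icc h1 hg1)
    refine ⟨?_, iξ.bdd_mul hh0.aestronglyMeasurable hb⟩
    have h2 := integral_congr_ae
      (condExp_stronglyMeasurable_mul_of_bound hm hh.stronglyMeasurable ik 1 hb)
    rw [integral_condExp hm] at h2
    calc crossCov μ h g = ∫ ω, h ω * k ω ∂μ := by
          simp only [hk, mul_sub, crossCov]
          rw [integral_sub ihg (ih.mul_const _), integral_mul_const]
      _ = _ := h2
  have hind : ∀ C, MeasurableSet[m] C → Measurable[m] (C.indicator (1 : Ω → ℝ)) ∧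
      ∀ ω, C.indicator (1 : Ω → ℝ) ω ∈ Set.Icc (0 : ℝ) 1 := by
    intro C hC
    refine ⟨Measurable.indicator (m := m) (@measurable_one ℝ Ω _ m _) hC, fun ω => ?_⟩
    by_cases h : ω ∈ C <;> simp [h]
  have hξm : Measurable[m] ξ := stronglyMeasurable_condExp.measurable
  obtain ⟨e1, i1⟩ := key f hf hf1
  rcases le_total 0 (crossCov μ f g) with hc | hc
  · have hC : MeasurableSet[m] {ω | 0 < ξ ω} := hξm measurableSet_Ioi
    obtain ⟨e2, i2⟩ := key _ (hind _ hC).1 (hind _ hC).2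
    refine ⟨_, hC, ?_⟩
    rw [abs_of_nonneg hc]
    refine le_trans ?_ (le_abs_self _)
    rw [e1, e2]
    refine integral_mono i1 i2 fun ω => ?_
    by_cases h : 0 < ξ ω
    · simp only [Set.indicator, Set.mem_ofPred_eq, h, if_true, Pi.one_apply]
      nlinarith [(hf1 ω).2]
    · simp only [Set.indicator, Set.mem_ofPred_eq, h, if_false]
      nlinarith [(hf1 ω).1]
  · have hC : MeasurableSet[m] {ω | ξ ω < 0} := hξm measurableSet_Iio
    obtain ⟨e2, i2⟩ := key _ (hind _ hC).1 (hind _ hC).2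
    refine ⟨_, hC, ?_⟩
    rw [abs_of_nonpos hc]
    refine le_trans ?_ (neg_le_abs _)
    rw [e1, e2]
    refine neg_le_neg (integral_mono i2 i1 fun ω => ?_)
    by_cases h : ξ ω < 0
    · simp only [Set.indicator, Set.mem_ofPred_eq, h, if_true, Pi.one_apply]
      nlinarith [(hf1 ω).2]
    · simp only [Set.indicator, Set.mem_ofPred_eq, h, if_false]
      nlinarith [(hf1 ω).1]

omit [IsProbabilityMeasure μ] in
lemma crossCov_indicator {A B : Set Ω} (hA : MeasurableSet A) (hB : MeasurableSet B) :
    crossCov μ (A.indicator 1) (B.indicator 1) = μ.real (A ∩ B) - μ.real A * μ.real B := by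
  have h : (fun ω => A.indicator (1 : Ω → ℝ) ω * B.indicator 1 ω) = (A ∩ B).indicator 1 := by
    rw [Set.inter_indicator_one]; rfl
  rw [crossCov, h, integral_indicator_one (hA.inter hB), integral_indicator_one hA,
    integral_indicator_one hB]

/-- Replacing each factor in turn by an extremal indicator loses no constant. -/
lemma abs_crossCov_le_alphaCoeff (h₁ : m₁ ≤ m0) (h₂ : m₂ ≤ m0)
    {f g : Ω → ℝ} (hf : Measurable[m₁] f) (hf1 : ∀ ω, f ω ∈ Set.Icc 0 1)
    (hg : Measurable[m₂] g) (hg1 : ∀ ω, g ω ∈ Set.Icc 0 1) :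
    |crossCov μ f g| ≤ alphaCoeff μ m₁ m₂ := by
  obtain ⟨A, hA, h3⟩ := exists_abs_crossCov_le_indicator (μ := μ) h₁ hf hf1
    (hg.mono h₂ le_rfl) hg1
  have hA1 : ∀ ω, A.indicator (1 : Ω → ℝ) ω ∈ Set.Icc (0 : ℝ) 1 := fun ω => by
    by_cases h : ω ∈ A <;> simp [h]
  obtain ⟨B, hB, h4⟩ := exists_abs_crossCov_le_indicator (μ := μ) h₂ hg hg1
    (measurable_one.indicator (h₁ _ hA)) hA1
  refine h3.trans ?_
  rw [crossCov_comm]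
  refine h4.trans ?_
  rw [crossCov_comm, crossCov_indicator (h₁ _ hA) (h₂ _ hB)]
  refine le_csSup ⟨1, ?_⟩ ⟨A, B, hA, hB, rfl⟩
  rintro c ⟨A, B, -, -, rfl⟩
  have h5 : μ.real (A ∩ B) ≤ 1 := measureReal_le_one
  have h6 : μ.real A * μ.real B ≤ 1 :=
    mul_le_one₀ measureReal_le_one measureReal_nonneg measureReal_le_one
  have h7 : 0 ≤ μ.real (A ∩ B) := measureReal_nonneg
  have h8 : 0 ≤ μ.real A * μ.real B := mul_nonneg measureReal_nonneg measureReal_nonneg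
  rw [abs_le]; constructor <;> linarith

omit [IsProbabilityMeasure μ] in
lemma integral_abs_toReal_sub_le {f g Δ : Ω → ℝ≥0∞} (hf : Measurable f) (hg : Measurable g)
    (hf1 : ∀ ω, f ω ≤ 1) (hg1 : ∀ ω, g ω ≤ 1) (hfg : ∀ᵐ ω ∂μ, f ω ≤ g ω + Δ ω)
    (hgf : ∀ᵐ ω ∂μ, g ω ≤ f ω + Δ ω) :
    ENNReal.ofReal (∫ ω, |(f ω).toReal - (g ω).toReal| ∂μ) ≤ ∫⁻ ω, Δ ω ∂μ := by
  have hm : Measurable fun ω => |(f ω).toReal - (g ω).toReal| :=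
    (hf.ennreal_toReal.sub hg.ennreal_toReal).abs
  rw [integral_eq_lintegral_of_nonneg_ae (ae_of_all _ fun _ => abs_nonneg _)
    hm.aestronglyMeasurable]
  refine ENNReal.ofReal_toReal_le.trans (lintegral_mono_ae ?_)
  filter_upwards [hfg, hgf] with ω h1 h2
  rcases eq_or_ne (Δ ω) ∞ with h | h
  · simp [h]
  have nf : f ω ≠ ∞ := ne_top_of_le_ne_top (by simp) (hf1 ω)
  have ng : g ω ≠ ∞ := ne_top_of_le_ne_top (by simp) (hg1 ω)
  have h1' := ENNReal.toReal_mono (by simp [ng, h]) h1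
  have h2' := ENNReal.toReal_mono (by simp [nf, h]) h2
  rw [ENNReal.toReal_add ng h] at h1'
  rw [ENNReal.toReal_add nf h] at h2'
  refine ENNReal.ofReal_le_of_le_toReal (abs_le.2 ⟨?_, ?_⟩) <;> linarith

lemma toReal_mem_Icc {f : Ω → ℝ≥0∞} (h : ∀ ω, f ω ≤ 1) (ω : Ω) :
    (f ω).toReal ∈ Set.Icc (0 : ℝ) 1 :=
  ⟨ENNReal.toReal_nonneg, by simpa using ENNReal.toReal_mono (by simp) (h ω)⟩

/-- The union of an increasing sequence of σ-algebras is a ring generating their supremum, so its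
sets approximate in measure of the symmetric difference. -/
lemma exists_measurableSet_integral_abs_indicator_sub_lt {𝓕 : ℕ → MeasurableSpace Ω}
    (hmono : Monotone 𝓕) (hle : ∀ n, 𝓕 n ≤ m0) {A : Set Ω} (hA : MeasurableSet[⨆ n, 𝓕 n] A)
    {ε : ℝ} (hε : 0 < ε) :
    ∃ (n : ℕ) (A' : Set Ω), MeasurableSet[𝓕 n] A' ∧
      ∫ ω, |A.indicator (1 : Ω → ℝ) ω - A'.indicator 1 ω| ∂μ ≤ ε := by
  have hsup : (⨆ n, 𝓕 n) ≤ m0 := iSup_le hle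
  set C : Set (Set Ω) := {s | ∃ n, MeasurableSet[𝓕 n] s} with hC
  have hring : IsSetRing C := by
    refine ⟨⟨0, @MeasurableSet.empty _ (𝓕 0)⟩, ?_, ?_⟩
    · rintro s t ⟨n, hs⟩ ⟨k, ht⟩
      exact ⟨max n k, @MeasurableSet.union _ (𝓕 _) _ _ (hmono (le_max_left n k) _ hs)
        (hmono (le_max_right n k) _ ht)⟩
    · rintro s t ⟨n, hs⟩ ⟨k, ht⟩
      exact ⟨max n k, @MeasurableSet.diff _ (𝓕 _) _ _ (hmono (le_max_left n k) _ hs)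
        (hmono (le_max_right n k) _ ht)⟩
  obtain ⟨A', ⟨n, hA'⟩, hlt⟩ := @exists_measure_symmDiff_lt_of_generateFrom_isSetRing Ω
    (⨆ n, 𝓕 n) (μ.trim hsup) _ C hring
    ⟨{Set.univ}, Set.countable_singleton _, by
      rintro _ rfl; exact ⟨0, @MeasurableSet.univ _ (𝓕 0)⟩, by simp⟩
    (MeasurableSpace.measurableSpace_iSup_eq 𝓕) A hA (ENNReal.ofReal ε) (by simpa using hε)
  have hA's : MeasurableSet[⨆ n, 𝓕 n] A' := le_iSup 𝓕 n _ hA'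
  have hsd : MeasurableSet[⨆ n, 𝓕 n] (symmDiff A' A) :=
    @MeasurableSet.symmDiff _ (⨆ n, 𝓕 n) _ _ hA's hA
  rw [trim_measurableSet_eq hsup hsd] at hlt
  refine ⟨n, A', hA', ?_⟩
  have : (fun ω => |A.indicator (1 : Ω → ℝ) ω - A'.indicator 1 ω|)
      = (symmDiff A' A).indicator 1 := by
    funext ω
    by_cases h1 : ω ∈ A <;> by_cases h2 : ω ∈ A' <;> simp [Set.mem_symmDiff, Set.indicator, h1, h2]
  rw [this, integral_indicator_one (hsup _ hsd)]
  exact ENNReal.toReal_le_of_le_ofReal hε.le hlt.le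

end Covariance

/-! ### Renewal estimates uniform in the window length. -/

section Series

variable {b e : ℕ → ℝ}

lemma sum_range_le_tsum_Ici (g : ℕ → ℝ≥0∞) {a c : ℕ} (h : a ≤ c) (M : ℕ) :
    ∑ i ∈ Finset.range M, g (c + i) ≤ ∑' t : Set.Ici a, g t := by
  have hinj : Function.Injective (fun i : ℕ => (⟨c + i, by
      simp only [Set.mem_Ici]; omega⟩ : Set.Ici a)) := by
    intro i j hij
    simpa using hij
  exact (ENNReal.sum_le_tsum _).trans
    (ENNReal.tsum_comp_le_tsum_of_injective hinj (fun t : Set.Ici a => g t))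

lemma tailSum_nonneg (he : ∀ j, 0 ≤ e j) (l : ℕ) : 0 ≤ tailSum e l :=
  tsum_nonneg fun _ => he _

lemma ofReal_tailSum (he : ∀ j, 0 ≤ e j) (hs : Summable e) (l : ℕ) :
    ENNReal.ofReal (tailSum e l) = ∑' j : ℕ, if l ≤ j then ENNReal.ofReal (e j) else 0 := by
  have h1 : Summable fun t : Set.Ici l => e t := hs.subtype _
  rw [tailSum, ENNReal.ofReal_tsum_of_nonneg (fun _ => he _) h1,
    tsum_subtype (Set.Ici l) fun j => ENNReal.ofReal (e j)]
  simp only [Set.indicator, Set.mem_Ici]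

lemma sum_le_conv {u v : ℕ → ℝ} (hu : ∀ n, 0 ≤ u n) (hv : ∀ n, 0 ≤ v n) {s t : ℕ} (h : s ≤ t) :
    ∑ l ∈ Finset.range s, v l * u (t - l) ≤ conv u v t := by
  calc ∑ l ∈ Finset.range s, v l * u (t - l)
      ≤ ∑ l ∈ Finset.range (t + 1), v l * u (t - l) :=
        Finset.sum_le_sum_of_subset_of_nonneg (by intro l; simp; omega)
          fun l _ _ => mul_nonneg (hv _) (hu _)
    _ = ∑ l ∈ Finset.range (t + 1), u (t + 1 - 1 - l) * v (t - (t + 1 - 1 - l)) := by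
        refine Finset.sum_congr rfl fun l hl => ?_
        have hl' : l < t + 1 := by simpa using hl
        rw [mul_comm]
        congr 2; omega
    _ = conv u v t := Finset.sum_range_reflect (fun j => u j * v (t - j)) (t + 1)

lemma ofReal_renewalValue_le_tsum (hb0 : ∀ m, 0 ≤ b m) (hb1 : ∀ m, b m ≤ 1) {M s : ℕ} :
    ENNReal.ofReal (renewalValue b (ltIndicator M) (s + M) 0) ≤
      ∑' t : Set.Ici (s - 1), ENNReal.ofReal (bStar b t) := by
  have h := renewalValue_ltIndicator_le hb0 hb1 M (s + M) (by omega)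
  refine (ENNReal.ofReal_le_ofReal h).trans ?_
  rw [← Finset.sum_range_reflect, ENNReal.ofReal_sum_of_nonneg fun _ _ => bStar_nonneg hb0 hb1 _]
  -- The indices that occur are s + 1, …, s + M.
  refine le_trans (le_of_eq ?_) (sum_range_le_tsum_Ici
    (fun t => ENNReal.ofReal (bStar b t)) (c := s + 1) (by omega) M)
  refine Finset.sum_congr rfl fun i hi => ?_
  have : i < M := by simpa using hi
  congr 2; omega

/-- Index the sum by l = s + M - 1 - i, the time elapsed since the covariates began to agree. For l
≥ s, inside the window, the restart cost is bounded by 1, giving the series of S. For l < s it is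
bounded by a sum of b*, giving the convolution. -/
lemma sum_tailSum_mul_renewalValue_le (hb0 : ∀ m, 0 ≤ b m) (hb1 : ∀ m, b m ≤ 1)
    (he : ∀ j, 0 ≤ e j) {M s : ℕ} :
    ∑ i ∈ Finset.range (s + M), ENNReal.ofReal (tailSum e (s + M - 1 - i)) *
        ENNReal.ofReal (renewalValue b (ltIndicator M) i 0) ≤
      ∑' t : Set.Ici s, ENNReal.ofReal (tailSum e t) +
      ∑' t : Set.Ici (s - 1), ENNReal.ofReal (conv (bStar b) (tailSum e) t) := by
  set W := renewalValue b (ltIndicator M)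
  have hW1 : ∀ i, W i 0 ≤ 1 :=
    fun i => renewalValue_le_one hb0 hb1 (ltIndicator_le_one M) i 0
  have hS := tailSum_nonneg he
  have hB := bStar_nonneg hb0 hb1
  rw [← Finset.sum_range_reflect, Finset.sum_range_add, add_comm]
  refine add_le_add ?_ ?_
  · refine le_trans (Finset.sum_le_sum fun i hi => ?_)
      (sum_range_le_tsum_Ici (fun t => ENNReal.ofReal (tailSum e t)) le_rfl M)
    have : i < M := by simpa using hi
    rw [show s + M - 1 - (s + M - 1 - (s + i)) = s + i by omega]
    exact mul_le_of_le_one_right' (by simpa using hW1 _)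
  · refine le_trans ?_ (sum_range_le_tsum_Ici
      (fun t => ENNReal.ofReal (conv (bStar b) (tailSum e) t)) (c := s) (by omega) M)
    calc _ ≤ ∑ l ∈ Finset.range s, ENNReal.ofReal
            (∑ i ∈ Finset.range M, tailSum e l * bStar b (s + i - l)) := by
          refine Finset.sum_le_sum fun l hl => ?_
          have hl' : l < s := by simpa using hl
          rw [← ENNReal.ofReal_mul (hS _), show s + M - 1 - (s + M - 1 - l) = l by omega]
          refine ENNReal.ofReal_le_ofReal ?_
          rw [← Finset.mul_sum]
          refine mul_le_mul_of_nonneg_left ?_ (hS l)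
          refine (renewalValue_ltIndicator_le hb0 hb1 M (s + M - 1 - l) (by omega)).trans ?_
          rw [← Finset.sum_range_reflect]
          refine le_of_eq (Finset.sum_congr rfl fun i hi => ?_)
          have : i < M := by simpa using hi
          congr 1; omega
      _ = ∑ i ∈ Finset.range M, ENNReal.ofReal
            (∑ l ∈ Finset.range s, tailSum e l * bStar b (s + i - l)) := by
          rw [← ENNReal.ofReal_sum_of_nonneg fun _ _ => Finset.sum_nonneg fun _ _ =>
              mul_nonneg (hS _) (hB _), Finset.sum_comm,
            ENNReal.ofReal_sum_of_nonneg fun _ _ => Finset.sum_nonneg fun _ _ =>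
              mul_nonneg (hS _) (hB _)]
      _ ≤ _ := Finset.sum_le_sum fun i _ => ENNReal.ofReal_le_ofReal
          (sum_le_conv hB hS (by omega))

lemma tendsto_renewalValue_ltIndicator (hb0 : ∀ m, 0 ≤ b m) (hb1 : ∀ m, b m ≤ 1) {a : ℕ}
    (h : ∑' t : Set.Ici a, ENNReal.ofReal (bStar b t) ≠ ∞) (M : ℕ) :
    Filter.Tendsto (fun k => renewalValue b (ltIndicator M) k 0) Filter.atTop (𝓝 0) := by
  have h1 : Filter.Tendsto (bStar b) Filter.atTop (𝓝 0) := by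
    have hinj : Function.Injective (fun i : ℕ => (⟨i + a, by simp⟩ : Set.Ici a)) := by
      intro i j hij
      simpa using hij
    have h2 := ne_top_of_le_ne_top h (ENNReal.tsum_comp_le_tsum_of_injective hinj
      (fun t : Set.Ici a => ENNReal.ofReal (bStar b t)))
    have h3 := (ENNReal.tendsto_toReal (by simp)).comp
      (ENNReal.tendsto_atTop_zero_of_tsum_ne_top h2)
    rw [← Filter.tendsto_add_atTop_iff_nat a]
    refine h3.congr fun i => ?_
    simp [ENNReal.toReal_ofReal (bStar_nonneg hb0 hb1 _)]
  have h2 : Filter.Tendsto (fun k => ∑ j ∈ Finset.range M, bStar b (k - j)) Filter.atTop (𝓝 0) := by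
    have := tendsto_finsetSum (Finset.range M)
      fun j _ => h1.comp (Filter.tendsto_sub_atTop_nat j)
    simpa using this
  refine tendsto_of_tendsto_of_tendsto_of_le_of_le' tendsto_const_nhds h2 ?_ ?_
  · exact .of_forall fun k => renewalValue_nonneg hb0 hb1 (ltIndicator_nonneg M) k 0
  · filter_upwards [Filter.eventually_ge_atTop M] with k hk
    exact renewalValue_ltIndicator_le hb0 hb1 M k hk

end Series

/-! ### A copy of `X` conditioned on its future. -/

section ConditionalCopy

variable {Ω F : Type*} [MeasurableSpace Ω] {μ : Measure Ω} [IsProbabilityMeasure μ]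
  [NormedAddCommGroup F] [MeasurableSpace F] {X : ℤ → Ω → F}

lemma measurable_maskPath (J : Set ℤ) :
    Measurable (fun x : ℤ → F => (J.indicator x : ℤ → F)) := by
  refine measurable_pi_lambda _ fun j => ?_
  by_cases h : j ∈ J
  · simpa [h] using measurable_pi_apply j
  · simp [h]

omit [MeasurableSpace Ω] in
lemma measurable_maskPath_sigmaGE (X : ℤ → Ω → F) (r : ℤ) :
    Measurable[sigmaGE X r] (fun ω => ((Set.Ici r).indicator (fun s => X s ω) : ℤ → F)) := by
  let _ : MeasurableSpace Ω := sigmaGE X r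
  refine measurable_pi_lambda _ fun j => ?_
  by_cases h : r ≤ j
  · simpa [h] using measurable_sigmaGE X h
  · simp [h]

omit [MeasurableSpace Ω] in
lemma measurable_maskPath_sigmaLE (X : ℤ → Ω → F) (r : ℤ) :
    Measurable[sigmaLE X r] (fun ω => ((Set.Iic r).indicator (fun s => X s ω) : ℤ → F)) := by
  let _ : MeasurableSpace Ω := sigmaLE X r
  refine measurable_pi_lambda _ fun j => ?_
  by_cases h : j ≤ r
  · simpa [h] using measurable_sigmaLE X h
  · simp [h]

/-- Given the future of `X` after time `r`, there is a copy of `X` with the same future. -/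
lemma exists_conditional_copy [NormedSpace ℝ F] [FiniteDimensional ℝ F] [BorelSpace F]
    (hX : ∀ t, Measurable (X t)) (r : ℤ) :
    ∃ κ : Kernel (ℤ → F) (ℤ → F), IsMarkovKernel κ ∧
      (∀ g : (ℤ → F) → ℝ≥0∞, Measurable g →
        ∫⁻ ω, ∫⁻ x', g x' ∂κ ((Set.Ici r).indicator fun s => X s ω) ∂μ
          = ∫⁻ ω, g (fun s => X s ω) ∂μ) ∧
      (∀ p : Set (ℤ → F), MeasurableSet p → (∀ᵐ ω ∂μ, (fun s => X s ω) ∈ p) →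
        ∀ᵐ ω ∂μ, ∀ᵐ x' ∂κ ((Set.Ici r).indicator fun s => X s ω), x' ∈ p) ∧
      (∀ᵐ ω ∂μ, ∀ᵐ x' ∂κ ((Set.Ici r).indicator fun s => X s ω), ∀ j, r ≤ j → x' j = X j ω) := by
  have : ProperSpace F := FiniteDimensional.proper ℝ F
  set U : Ω → ℤ → F := fun ω => (Set.Ici r).indicator fun s => X s ω with hU
  set Z : Ω → ℤ → F := fun ω s => X s ω
  have hZ : Measurable Z := measurable_path hX
  have hUm : Measurable U := (measurable_maskPath _).comp hZ
  have hjoint := compProd_map_condDistrib (mβ := inferInstance) (X := U) (μ := μ) hZ.aemeasurable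
  have hgen : ∀ q : Set ((ℤ → F) × (ℤ → F)), MeasurableSet q → (∀ᵐ ω ∂μ, (U ω, Z ω) ∈ q) →
      ∀ᵐ ω ∂μ, ∀ᵐ x' ∂condDistrib Z U μ (U ω), (U ω, x') ∈ q := by
    intro q hq h
    have h1 : ∀ᵐ p ∂(μ.map fun ω => (U ω, Z ω)), p ∈ q :=
      (ae_map_iff (hUm.prodMk hZ).aemeasurable hq).2 h
    rw [← hjoint] at h1
    exact ae_of_ae_map hUm.aemeasurable (Measure.ae_ae_of_ae_compProd h1)
  refine ⟨condDistrib Z U μ, inferInstance, fun g hg => ?_, fun p hp h => ?_, ?_⟩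
  · have h1 := Measure.lintegral_compProd (μ := μ.map U) (κ := condDistrib Z U μ)
      (f := fun p => g p.2) (hg.comp measurable_snd)
    rw [hjoint, lintegral_map (f := fun p : (ℤ → F) × (ℤ → F) => g p.2)
      (hg.comp measurable_snd) (hUm.prodMk hZ), lintegral_map hg.lintegral_kernel hUm] at h1
    exact h1.symm
  · exact hgen (Prod.snd ⁻¹' p) (measurable_snd hp) h
  -- The joint law of (`U`, `Z`) is carried by the pairs whose second entry masks to the first;
  -- disintegrating, the copy has the prescribed future.
  · have hq : MeasurableSet {p : (ℤ → F) × (ℤ → F) | (Set.Ici r).indicator p.2 = p.1} :=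
      measurableSet_eq_fun ((measurable_maskPath _).comp measurable_snd) measurable_fst
    filter_upwards [hgen _ hq (ae_of_all _ fun ω => rfl)] with ω hω
    filter_upwards [hω] with x' hx' j hj
    have := congrFun hx' j
    simpa [hU, Set.indicator, hj] using this

end ConditionalCopy

/-! ### Events depending on finitely many coordinates. -/

section Window

variable {Ω E F : Type*} [MeasurableSpace E] [NormedAddCommGroup F] [MeasurableSpace F]

/-- An event which depends on finitely many coordinates of `(Y, X)`, as a set of pasts and paths. -/
lemma exists_window_set (X : ℤ → Ω → F) (Y : ℤ → Ω → E) (y₀ : E) {N : ℤ} {M : ℕ} {I J : Set ℤ}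
    (hI : ∀ j ∈ I, j ≤ N ∧ N - j < M ∧ j ∈ J) {A : Set Ω}
    (hA : MeasurableSet[⨆ j ∈ I, MeasurableSpace.comap (fun ω => (Y j ω, X j ω)) inferInstance] A) :
    ∃ S : Set ((ℕ → E) × (ℤ → F)), MeasurableSet S ∧
      (∀ ω, (past Y N ω, fun s => X s ω) ∈ S ↔ ω ∈ A) ∧
      ∀ (y y' : ℕ → E) (x x' : ℤ → F), (∀ j < M, y j = y' j) → (∀ j ∈ J, x j = x' j) →
        ((y, x) ∈ S ↔ (y', x') ∈ S) := by
  -- `Ψ` overwrites the coordinates outside the window by `y₀` and 0, so every preimage under `Ψ`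
  -- has the required invariance.
  set Ψ : (ℕ → E) × (ℤ → F) → (ℕ → E) × (ℤ → F) :=
    fun p => (fun i => if i < M then p.1 i else y₀, J.indicator p.2) with hΨ
  have hΨm : Measurable Ψ := by
    refine Measurable.prodMk (measurable_pi_lambda _ fun i => ?_)
      ((measurable_maskPath J).comp measurable_snd)
    by_cases h : i < M
    · simp only [h, if_true]
      exact (measurable_pi_apply i).comp measurable_fst
    · simp [h]
  have hle : (⨆ j ∈ I, MeasurableSpace.comap (fun ω => (Y j ω, X j ω)) inferInstance) ≤
      MeasurableSpace.comap (fun ω => Ψ (past Y N ω, fun s => X s ω)) inferInstance := by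
    refine iSup₂_le fun j hj => ?_
    obtain ⟨h1, h2, h3⟩ := hI j hj
    have hfac : (fun ω => (Y j ω, X j ω)) = (fun p : (ℕ → E) × (ℤ → F) =>
        (p.1 (N - j).toNat, p.2 j)) ∘ fun ω => Ψ (past Y N ω, fun s => X s ω) := by
      funext ω
      have h4 : (N - j).toNat < M := by omega
      have h5 : N - max (N - j) 0 = j := by omega
      simp [hΨ, h3, h4, past, h5]
    rw [hfac, ← MeasurableSpace.comap_comp]
    refine MeasurableSpace.comap_mono (Measurable.comap_le ?_)
    exact ((measurable_pi_apply _).comp measurable_fst).prodMk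
      ((measurable_pi_apply _).comp measurable_snd)
  obtain ⟨S', hS', rfl⟩ := hle _ hA
  refine ⟨Ψ ⁻¹' S', hΨm hS', fun ω => Iff.rfl, fun y y' x x' hy hx => ?_⟩
  have : Ψ (y, x) = Ψ (y', x') := by
    refine Prod.ext (funext fun i => ?_) (funext fun j => ?_)
    · by_cases h : i < M
      · simp [hΨ, h, hy i h]
      · simp [hΨ, h]
    · by_cases h : j ∈ J
      · simp [hΨ, h, hx j h]
      · simp [hΨ, h]
  simp only [Set.mem_preimage, this]

end Window

/-! ### Replacing a past event by a function of the past of `X`. -/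

section Approximation

variable {Ω E F : Type*} [MeasurableSpace Ω] {μ : Measure Ω} [IsProbabilityMeasure μ]
  [Countable E] [MeasurableSpace E] [MeasurableSingletonClass E]
  [NormedAddCommGroup F] [MeasurableSpace F] {D : Set (ℕ → F)}
  {P : Kernel ((ℕ → E) × D) E} [IsMarkovKernel P] {ρ : (ℕ → F) → D}
  {X : ℤ → Ω → F} {Y : ℤ → Ω → E} {N : ℤ} {M : ℕ} {S : Set ((ℕ → E) × (ℤ → F))} {A : Set Ω}

lemma crossCov_indicator_eq_iterBack (hX : ∀ t, Measurable (X t)) (hY : ∀ t, Measurable (Y t))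
    (hXD : ∀ᵐ ω ∂μ, ∀ t, past X t ω ∈ D) (hρ : Measurable ρ) (hρD : ∀ x ∈ D, (ρ x : ℕ → F) = x)
    (hmodel : SolvesModel μ P X Y) (hexo : StrictlyExogenous μ X Y)
    (hS : MeasurableSet S) (hA : ∀ ω, (past Y N ω, fun s => X s ω) ∈ S ↔ ω ∈ A) (k : ℕ)
    {g : Ω → ℝ} (hg : Measurable[sigmaPastPath Y X (N - k)] g)
    (hg1 : ∀ ω, g ω ∈ Set.Icc (0 : ℝ) 1) :
    crossCov μ (A.indicator 1) g = crossCov μ (fun ω =>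
      (iterBack P ρ N (S.indicator 1) k (past Y (N - k) ω, fun s => X s ω)).toReal) g := by
  have hψm : Measurable (S.indicator (1 : (ℕ → E) × (ℤ → F) → ℝ≥0∞)) := measurable_one.indicator hS
  have hψ1 : ∀ p, S.indicator (1 : (ℕ → E) × (ℤ → F) → ℝ≥0∞) p ≤ 1 := fun p =>
    Set.indicator_le_self' (by simp) p
  have hm := sigmaPastPath_le hY hX (N - k)
  have hpm : ∀ t, Measurable fun ω => (past Y t ω, fun s => X s ω) :=
    fun t => (measurable_past hY t).prodMk (measurable_path hX)
  have hind : ∀ ω, A.indicator (1 : Ω → ℝ) ω =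
      (S.indicator (1 : (ℕ → E) × (ℤ → F) → ℝ≥0∞) (past Y N ω, fun s => X s ω)).toReal := by
    intro ω
    by_cases h : ω ∈ A
    · simp [h, (hA ω).2 h]
    · simp [h, mt (hA ω).1 h]
  have key : ∀ h : Ω → ℝ, Measurable[sigmaPastPath Y X (N - k)] h →
      (∀ ω, h ω ∈ Set.Icc (0 : ℝ) 1) →
      ∫ ω, A.indicator (1 : Ω → ℝ) ω * h ω ∂μ = ∫ ω, (iterBack P ρ N (S.indicator 1) k
        (past Y (N - k) ω, fun s => X s ω)).toReal * h ω ∂μ := by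
    intro h hh hh1
    have hreal : ∀ f : Ω → ℝ≥0∞, Measurable f → (∀ ω, f ω ≤ 1) →
        ∫ ω, (f ω).toReal * h ω ∂μ = (∫⁻ ω, ENNReal.ofReal (h ω) * f ω ∂μ).toReal := by
      intro f hf hf1
      rw [← integral_toReal (f := fun ω => ENNReal.ofReal (h ω) * f ω)
        ((hh.mono hm le_rfl).ennreal_ofReal.mul hf).aemeasurable
        (ae_of_all _ fun ω => ENNReal.mul_lt_top (by simp) ((hf1 ω).trans_lt (by simp)))]
      refine integral_congr_ae (ae_of_all _ fun ω => ?_)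
      simp [ENNReal.toReal_mul, ENNReal.toReal_ofReal (hh1 ω).1, mul_comm]
    simp_rw [hind]
    rw [hreal (fun ω => S.indicator 1 (past Y N ω, fun s => X s ω)) (hψm.comp (hpm N))
        (fun ω => hψ1 _),
      hreal (fun ω => iterBack P ρ N (S.indicator 1) k (past Y (N - k) ω, fun s => X s ω))
        ((measurable_iterBack hρ hψm k).comp (hpm _)) (fun ω => iterBack_le_one hψ1 k _),
      lintegral_mul_iterBack hX hY hXD hρ hρD hmodel hexo N hψm k hh.ennreal_ofReal]
  have h1 := key (fun _ => 1) (@measurable_const _ _ _ (sigmaPastPath Y X (N - k)) _) (by simp)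
  simp only [mul_one] at h1
  simp only [crossCov]
  rw [key g hg hg1, h1]

/-- The approximation is the backward integral started from the fixed past `y₀` instead of the true
one. The covariate path is unchanged, so only the pure renewal term remains. -/
lemma exists_past_approximation (hX : ∀ t, Measurable (X t)) (hY : ∀ t, Measurable (Y t))
    (hXD : ∀ᵐ ω ∂μ, ∀ t, past X t ω ∈ D) (hρ : Measurable ρ) (hρD : ∀ x ∈ D, (ρ x : ℕ → F) = x)
    (hmodel : SolvesModel μ P X Y) (hexo : StrictlyExogenous μ X Y) (y₀ : ℕ → E)
    (hS : MeasurableSet S) (hA : ∀ ω, (past Y N ω, fun s => X s ω) ∈ S ↔ ω ∈ A)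
    (hinv : ∀ (y y' : ℕ → E) (x x' : ℤ → F), (∀ j < M, y j = y' j) →
      (∀ j ∈ Set.Iic N, x j = x' j) → ((y, x) ∈ S ↔ (y', x') ∈ S)) (k : ℕ) :
    ∃ g : Ω → ℝ, Measurable[sigmaLE X N] g ∧ (∀ ω, g ω ∈ Set.Icc (0 : ℝ) 1) ∧
      ∀ h : Ω → ℝ, Measurable[sigmaAll X] h → (∀ ω, h ω ∈ Set.Icc (0 : ℝ) 1) →
        |crossCov μ (A.indicator 1) h - crossCov μ g h| ≤
          2 * renewalValue (bCoeff P) (ltIndicator M) k 0 := by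
  set ψ : (ℕ → E) × (ℤ → F) → ℝ≥0∞ := S.indicator 1 with hψ
  have hψm : Measurable ψ := measurable_one.indicator hS
  have hψ1 : ∀ p, ψ p ≤ 1 := fun p => Set.indicator_le_self' (by simp) p
  have hψeq : ∀ (y y' : ℕ → E) (x x' : ℤ → F), (∀ j < M, y j = y' j) →
      (∀ j ∈ Set.Iic N, x j = x' j) → ψ (y, x) = ψ (y', x') := by
    intro y y' x x' hy hx
    have h := hinv y y' x x' hy hx
    by_cases h' : (y', x') ∈ S
    · simp [hψ, h', h.2 h']
    · simp [hψ, h', mt h.1 h']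
  have hFm := measurable_iterBack (P := P) (N := N) hρ hψm k
  have hF1 := iterBack_le_one (P := P) (ρ := ρ) (N := N) hψ1 k
  have hconst : ∀ t, Measurable fun ω => (past Y t ω, fun s => X s ω) :=
    fun t => (measurable_past hY t).prodMk (measurable_path hX)
  have hconst' : Measurable fun ω => (y₀, fun s => X s ω) :=
    measurable_const.prodMk (measurable_path hX)
  refine ⟨fun ω => (iterBack P ρ N ψ k (y₀, fun s => X s ω)).toReal, ?_,
    toReal_mem_Icc fun ω => hF1 _, fun h hh hh1 => ?_⟩
  · have : (fun ω => (iterBack P ρ N ψ k (y₀, fun s => X s ω)).toReal) = (fun ω =>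
        (iterBack P ρ N ψ k (y₀, (Set.Iic N).indicator fun s => X s ω)).toReal) := by
      funext ω
      have hx : ∀ j ∈ Set.Iic N, X j ω = (Set.Iic N).indicator (fun s => X s ω) j := by
        intro j hj
        rw [Set.indicator_of_mem hj]
      rw [iterBack_congr_path (fun y => hψeq y y _ _ (fun _ _ => rfl) hx) hx]
    rw [this]
    have h2 : Measurable fun x => iterBack P ρ N ψ k (y₀, x) :=
      hFm.comp (measurable_const.prodMk measurable_id)
    exact h2.ennreal_toReal.comp (measurable_maskPath_sigmaLE X N)
  · rw [crossCov_indicator_eq_iterBack hX hY hXD hρ hρD hmodel hexo hS hA k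
      (hh.mono le_sup_right le_rfl) hh1]
    refine (abs_crossCov_sub_le (hFm.comp (hconst _)).ennreal_toReal
      (hFm.comp hconst').ennreal_toReal (hh.mono (sigmaAll_le hX) le_rfl)
      (toReal_mem_Icc fun ω => hF1 _) (toReal_mem_Icc fun ω => hF1 _) hh1).trans ?_
    refine mul_le_mul_of_nonneg_left ?_ zero_le_two
    have hcmp : ∀ (x : ℤ → F) (y y' : ℕ → E), iterBack P ρ N ψ k (y, x) ≤
        iterBack P ρ N ψ k (y', x) +
          ENNReal.ofReal (renewalValue (bCoeff P) (ltIndicator M) k 0) := by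
      intro x y y'
      simpa using iterBack_le_add (P := P) (ρ := ρ) (N := N) (x := x) (x' := x) hψ1
        (fun y y' hy => (hψeq y y' x x hy fun _ _ => rfl).le) (fun _ => 0)
        (fun t y => by simp [dTV]) k 0 y y' (by simp)
    have := integral_abs_toReal_sub_le (μ := μ)
      (f := fun ω => iterBack P ρ N ψ k (past Y (N - k) ω, fun s => X s ω))
      (g := fun ω => iterBack P ρ N ψ k (y₀, fun s => X s ω))
      (Δ := fun _ => ENNReal.ofReal (renewalValue (bCoeff P) (ltIndicator M) k 0))
      (hFm.comp (hconst _)) (hFm.comp hconst') (fun ω => hF1 _) (fun ω => hF1 _)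
      (ae_of_all _ fun ω => hcmp _ _ _) (ae_of_all _ fun ω => hcmp _ _ _)
    rw [lintegral_const, measure_univ, mul_one] at this
    exact (ENNReal.ofReal_le_ofReal_iff (renewalValue_nonneg (bCoeff_nonneg P) (bCoeff_le_one P)
      (ltIndicator_nonneg M) k 0)).1 this

end Approximation

/-! ### Replacing a future event by a function of the future of `X`. -/

section Future

variable {Ω E F : Type*} [MeasurableSpace Ω] {μ : Measure Ω} [IsProbabilityMeasure μ]
  [NormedAddCommGroup F] [MeasurableSpace F] [BorelSpace F]
  {D : Set (ℕ → F)} {ρ : (ℕ → F) → D} {X : ℤ → Ω → F} {e : ℕ → ℝ}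

/-- The part of `∑ j, e j * ‖x (t - 1 - j)‖` that comes from the times before `r`. -/
def lagNorm (e : ℕ → ℝ) (r t : ℤ) (x : ℤ → F) : ℝ≥0∞ :=
  ∑' j : ℕ, (if t - r ≤ (j : ℤ) then ENNReal.ofReal (e j) else 0) * ‖x (t - 1 - j)‖ₑ

lemma measurable_lagNorm (e : ℕ → ℝ) (r t : ℤ) :
    Measurable (lagNorm e r t : (ℤ → F) → ℝ≥0∞) :=
  Measurable.tsum fun _ => (measurable_pi_apply _).enorm.const_mul _

omit [IsProbabilityMeasure μ] in
lemma lintegral_lagNorm (hX : ∀ t, Measurable (X t)) (herg : StationaryErgodic μ X)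
    (he : ∀ j, 0 ≤ e j) (hs : Summable e) {r t : ℤ} {l : ℕ} (hl : t - r = l) :
    ∫⁻ ω, lagNorm e r t (fun s => X s ω) ∂μ =
      ENNReal.ofReal (tailSum e l) * ∫⁻ ω, ‖X 0 ω‖ₑ ∂μ := by
  simp only [lagNorm]
  rw [lintegral_tsum fun j => ((hX _).enorm.const_mul _).aemeasurable, ofReal_tailSum he hs,
    ← ENNReal.tsum_mul_right]
  refine tsum_congr fun j => ?_
  rw [lintegral_const_mul _ (hX _).enorm, herg.lintegral_enorm hX]
  simp only [hl, Nat.cast_le]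

variable [Countable E] [MeasurableSpace E] [MeasurableSingletonClass E]
  {P : Kernel ((ℕ → E) × D) E} [IsMarkovKernel P] {Y : ℤ → Ω → E}
  {M : ℕ} {S : Set ((ℕ → E) × (ℤ → F))} {A : Set Ω} {a : ℕ → ℝ}

omit [MeasurableSpace Ω] [BorelSpace F] [Countable E] [MeasurableSingletonClass E]
  [IsMarkovKernel P] in
lemma ofReal_dTV_le_lagNorm (hA4 : AssumptionA4 P a e) (hρD : ∀ x ∈ D, (ρ x : ℕ → F) = x)
    {r : ℤ} {x x' : ℤ → F} (hx : ∀ t, pathPast x t ∈ D) (hx' : ∀ t, pathPast x' t ∈ D)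
    (hxx : ∀ j, r ≤ j → x j = x' j) (t : ℤ) (y : ℕ → E) :
    ENNReal.ofReal (dTV (P (y, ρ (pathPast x (t - 1)))) (P (y, ρ (pathPast x' (t - 1))))) ≤
      lagNorm e r t x + lagNorm e r t x' := by
  refine (hA4.2.2.2.2 y y _ _).trans ?_
  rw [hρD _ (hx _), hρD _ (hx' _)]
  simp only [ne_eq, not_true_eq_false, if_false, tsum_zero, zero_add]
  rw [lagNorm, lagNorm, ← ENNReal.tsum_add]
  refine ENNReal.tsum_le_tsum fun j => ?_
  simp only [pathPast]
  rw [← mul_add]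
  by_cases h : t - r ≤ (j : ℤ)
  · rw [if_pos h, ENNReal.ofReal_mul (hA4.2.1 j), ofReal_norm]
    gcongr
    exact enorm_sub_le
  · rw [hxx _ (by omega)]
    simp

lemma exists_future_approximation [NormedSpace ℝ F] [FiniteDimensional ℝ F]
    (hX : ∀ t, Measurable (X t)) (hY : ∀ t, Measurable (Y t))
    (herg : StationaryErgodic μ X) (hD : MeasurableSet D)
    (hXD : ∀ᵐ ω ∂μ, ∀ t, past X t ω ∈ D) (hρ : Measurable ρ) (hρD : ∀ x ∈ D, (ρ x : ℕ → F) = x)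
    (hmodel : SolvesModel μ P X Y) (hexo : StrictlyExogenous μ X Y)
    (hA4 : AssumptionA4 P a e) (y₀ : ℕ → E) {r N : ℤ} {k : ℕ} (hk : N - k = r - 1)
    (hS : MeasurableSet S) (hA : ∀ ω, (past Y N ω, fun s => X s ω) ∈ S ↔ ω ∈ A)
    (hinv : ∀ (y y' : ℕ → E) (x x' : ℤ → F), (∀ j < M, y j = y' j) →
      (∀ j ∈ Set.Ici r, x j = x' j) → ((y, x) ∈ S ↔ (y', x') ∈ S)) :
    ∃ (h : Ω → ℝ) (d : ℝ), Measurable[sigmaGE X r] h ∧ (∀ ω, h ω ∈ Set.Icc (0 : ℝ) 1) ∧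
      (ENNReal.ofReal d ≤ ENNReal.ofReal (renewalValue (bCoeff P) (ltIndicator M) k 0) +
        2 * (∫⁻ ω, ‖X 0 ω‖ₑ ∂μ) * ∑ i ∈ Finset.range k, ENNReal.ofReal (tailSum e (k - 1 - i)) *
          ENNReal.ofReal (renewalValue (bCoeff P) (ltIndicator M) i 0)) ∧
      ∀ g : Ω → ℝ, Measurable[sigmaPastPath Y X (r - 1)] g → (∀ ω, g ω ∈ Set.Icc (0 : ℝ) 1) →
        |crossCov μ (A.indicator 1) g - crossCov μ h g| ≤ 2 * d := by
  set ψ : (ℕ → E) × (ℤ → F) → ℝ≥0∞ := S.indicator 1 with hψ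
  have hψm : Measurable ψ := measurable_one.indicator hS
  have hψ1 : ∀ p, ψ p ≤ 1 := fun p => Set.indicator_le_self' (by simp) p
  have hψeq : ∀ (y y' : ℕ → E) (x x' : ℤ → F), (∀ j < M, y j = y' j) →
      (∀ j ∈ Set.Ici r, x j = x' j) → ψ (y, x) = ψ (y', x') := by
    intro y y' x x' hy hx
    have h := hinv y y' x x' hy hx
    by_cases h' : (y', x') ∈ S
    · simp [hψ, h', h.2 h']
    · simp [hψ, h', mt h.1 h']
  set W : ℕ → ℝ≥0∞ :=
    fun i => ENNReal.ofReal (renewalValue (bCoeff P) (ltIndicator M) i 0) with hW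
  have hFm := measurable_iterBack (P := P) (N := N) hρ hψm k
  have hF1 := iterBack_le_one (P := P) (ρ := ρ) (N := N) hψ1 k
  set q : (ℤ → F) → ℝ≥0∞ := fun x => ∑ i ∈ Finset.range k, lagNorm e r (N - i) x * W i with hq
  have hqm : Measurable q :=
    Finset.measurable_fun_sum _ fun i _ => (measurable_lagNorm e r _).mul_const _
  have hcmp : ∀ x x' : ℤ → F, (∀ t, pathPast x t ∈ D) → (∀ t, pathPast x' t ∈ D) →
      (∀ j, r ≤ j → x j = x' j) → ∀ y y' : ℕ → E,
      iterBack P ρ N ψ k (y, x) ≤ iterBack P ρ N ψ k (y', x') + (W k + q x + q x') := by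
    intro x x' hx hx' hxx y y'
    refine (iterBack_le_add (P := P) (ρ := ρ) (N := N) hψ1
      (fun y y' hy => (hψeq y y' x x' hy hxx).le) (fun t => lagNorm e r t x + lagNorm e r t x')
      (ofReal_dTV_le_lagNorm hA4 hρD hx hx' hxx) k 0 y y' (by simp)).trans_eq ?_
    simp only [hq, add_mul, Finset.sum_add_distrib, add_assoc]
    rfl
  obtain ⟨κ, hκ, hκlaw, hκD, hκeq⟩ := exists_conditional_copy (μ := μ) hX r
  set U : Ω → ℤ → F := fun ω => (Set.Ici r).indicator fun s => X s ω
  have hUm : Measurable[sigmaGE X r] U := measurable_maskPath_sigmaGE X r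
  have hUm0 : Measurable U := hUm.mono (sigmaGE_le hX r) le_rfl
  have hF0m : Measurable fun x => iterBack P ρ N ψ k (y₀, x) :=
    hFm.comp (measurable_const.prodMk measurable_id)
  -- Fixing the past of `Y` and averaging over the copy leaves a function of X_j, j ≥ r, alone.
  set H : Ω → ℝ≥0∞ := fun ω => ∫⁻ x', iterBack P ρ N ψ k (y₀, x') ∂κ (U ω) with hH
  have hHm : Measurable[sigmaGE X r] H := (hF0m.lintegral_kernel (κ := κ)).comp hUm
  have hH1 : ∀ ω, H ω ≤ 1 := fun ω =>
    calc H ω ≤ ∫⁻ _, 1 ∂κ (U ω) := lintegral_mono fun x' => hF1 _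
      _ = 1 := by simp
  have hpast : Measurable fun ω => (past Y (N - k) ω, fun s => X s ω) :=
    (measurable_past hY _).prodMk (measurable_path hX)
  set f : Ω → ℝ≥0∞ := fun ω => iterBack P ρ N ψ k (past Y (N - k) ω, fun s => X s ω)
  have hfm : Measurable f := hFm.comp hpast
  set Δ : Ω → ℝ≥0∞ := fun ω => W k + q (fun s => X s ω) + ∫⁻ x', q x' ∂κ (U ω) with hΔ
  have hDall : MeasurableSet {x : ℤ → F | ∀ t, pathPast x t ∈ D} := by
    rw [Set.ofPred_forall]
    exact MeasurableSet.iInter fun t => measurable_pathPast t hD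
  have hae : ∀ᵐ ω ∂μ, f ω ≤ H ω + Δ ω ∧ H ω ≤ f ω + Δ ω := by
    filter_upwards [hXD, hκD _ hDall hXD, hκeq] with ω h1 h2 h3
    have e1 : ∀ c : ℝ≥0∞, ∫⁻ _, c ∂κ (U ω) = c := fun c => by simp
    constructor
    · calc f ω = ∫⁻ _, f ω ∂κ (U ω) := (e1 _).symm
        _ ≤ ∫⁻ x', (iterBack P ρ N ψ k (y₀, x') + (W k + q (fun s => X s ω) + q x')) ∂κ (U ω) := by
            refine lintegral_mono_ae ?_
            filter_upwards [h2, h3] with x' h4 h5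
            exact hcmp (fun s => X s ω) _ h1 h4 (fun j hj => (h5 j hj).symm) _ _
        _ = H ω + Δ ω := by
            rw [lintegral_add_left hF0m, lintegral_add_left measurable_const, e1]
    · calc H ω ≤ ∫⁻ x', (f ω + (W k + q (fun s => X s ω) + q x')) ∂κ (U ω) := by
            refine lintegral_mono_ae ?_
            filter_upwards [h2, h3] with x' h4 h5
            refine (hcmp x' (fun s => X s ω) h4 h1 h5 y₀ (past Y (N - k) ω)).trans_eq ?_
            rw [add_right_comm (W k)]
        _ = f ω + Δ ω := by
            rw [lintegral_add_left measurable_const, lintegral_add_left measurable_const, e1, e1]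
  have hqint : ∫⁻ ω, q (fun s => X s ω) ∂μ = (∫⁻ ω, ‖X 0 ω‖ₑ ∂μ) *
      ∑ i ∈ Finset.range k, ENNReal.ofReal (tailSum e (k - 1 - i)) * W i := by
    have hL : ∀ t, Measurable fun ω => lagNorm e r t fun s => X s ω :=
      fun t => (measurable_lagNorm e r t).comp (measurable_path hX)
    simp only [hq]
    rw [lintegral_finsetSum _ fun i _ => (hL _).mul_const _, Finset.mul_sum]
    refine Finset.sum_congr rfl fun i hi => ?_
    have hi' : i < k := by simpa using hi
    rw [lintegral_mul_const _ (hL _),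
      lintegral_lagNorm hX herg hA4.2.1 hA4.2.2.2.1 (l := k - 1 - i) (by omega)]
    ring
  -- The path and its copy have the same law and contribute equally, whence the factor 2.
  have hΔint : ∫⁻ ω, Δ ω ∂μ = W k + 2 * (∫⁻ ω, ‖X 0 ω‖ₑ ∂μ) *
      ∑ i ∈ Finset.range k, ENNReal.ofReal (tailSum e (k - 1 - i)) * W i := by
    have hqX : Measurable fun ω => W k + q fun s => X s ω :=
      measurable_const.add (hqm.comp (measurable_path hX))
    simp only [hΔ]
    rw [lintegral_add_left hqX,
      lintegral_add_left measurable_const, hκlaw q hqm, hqint]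
    simp only [lintegral_const, measure_univ, mul_one]
    ring
  refine ⟨fun ω => (H ω).toReal, ∫ ω, |(f ω).toReal - (H ω).toReal| ∂μ, hHm.ennreal_toReal,
    toReal_mem_Icc hH1, ?_, fun g hg hg1 => ?_⟩
  · rw [← hΔint]
    exact integral_abs_toReal_sub_le hfm (hHm.mono (sigmaGE_le hX r) le_rfl) (fun ω => hF1 _) hH1
      (hae.mono fun ω h => h.1) (hae.mono fun ω h => h.2)
  · rw [crossCov_indicator_eq_iterBack hX hY hXD hρ hρD hmodel hexo hS hA k (by rwa [hk]) hg1]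
    exact abs_crossCov_sub_le hfm.ennreal_toReal
      (hHm.mono (sigmaGE_le hX r) le_rfl).ennreal_toReal
      (hg.mono (sigmaPastPath_le hY hX _) le_rfl) (toReal_mem_Icc fun ω => hF1 _)
      (toReal_mem_Icc hH1) hg1

end Future

/-! ### Finite windows exhaust the past and the future. -/

section Windows

variable {Ω H : Type*} [MeasurableSpace H]

/-- The σ-algebra generated by `V_j`, `j ∈ I`. -/
@[reducible] def sigmaOn (V : ℤ → Ω → H) (I : Set ℤ) : MeasurableSpace Ω :=
  ⨆ j ∈ I, MeasurableSpace.comap (V j) inferInstance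

lemma sigmaOn_mono (V : ℤ → Ω → H) {I J : Set ℤ} (h : I ⊆ J) : sigmaOn V I ≤ sigmaOn V J :=
  biSup_mono h

lemma sigmaOn_le [m0 : MeasurableSpace Ω] {V : ℤ → Ω → H} (hV : ∀ t, Measurable (V t))
    (I : Set ℤ) : sigmaOn V I ≤ m0 :=
  iSup₂_le fun s _ => (hV s).comap_le

lemma sigmaLE_le_iSup_sigmaOn (V : ℤ → Ω → H) (k : ℤ) :
    sigmaLE V k ≤ ⨆ m : ℕ, sigmaOn V (Set.Ioc (k - m) k) :=
  iSup₂_le fun j hj => le_iSup_of_le ((k - j).toNat + 1)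
    (le_iSup₂_of_le (f := fun j _ => MeasurableSpace.comap (V j) inferInstance) j
      ⟨by push_cast; omega, hj⟩ le_rfl)

lemma sigmaGE_le_iSup_sigmaOn (V : ℤ → Ω → H) (k : ℤ) :
    sigmaGE V k ≤ ⨆ m : ℕ, sigmaOn V (Set.Icc k (k + m)) :=
  iSup₂_le fun j hj => le_iSup_of_le (j - k).toNat
    (le_iSup₂_of_le (f := fun j _ => MeasurableSpace.comap (V j) inferInstance) j
      ⟨hj, by omega⟩ le_rfl)

end Windows

/-! ### Assembling the bound for window events. -/

section Final

variable {Ω E F : Type*} [MeasurableSpace Ω] {μ : Measure Ω} [IsProbabilityMeasure μ]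
  [Countable E] [MeasurableSpace E] [MeasurableSingletonClass E]
  [NormedAddCommGroup F] [NormedSpace ℝ F] [FiniteDimensional ℝ F]
  [MeasurableSpace F] [BorelSpace F] {D : Set (ℕ → F)}
  {P : Kernel ((ℕ → E) × D) E} [IsMarkovKernel P] {X : ℤ → Ω → F} {Y : ℤ → Ω → E} {a e : ℕ → ℝ}

omit [Countable E] [MeasurableSingletonClass E] [NormedSpace ℝ F] [FiniteDimensional ℝ F]
  [BorelSpace F] [NormedAddCommGroup F] [MeasurableSpace Ω] in
lemma sigmaOn_prod_le_sigmaPastPath (X : ℤ → Ω → F) (Y : ℤ → Ω → E) {I : Set ℤ} {t : ℤ}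
    (h : ∀ j ∈ I, j ≤ t) : sigmaOn (fun j ω => (Y j ω, X j ω)) I ≤ sigmaPastPath Y X t := by
  let _ : MeasurableSpace Ω := sigmaPastPath Y X t
  exact iSup₂_le fun j hj => Measurable.comap_le (Measurable.prodMk
    ((measurable_sigmaLE Y (h j hj)).mono le_sup_left le_rfl)
    ((measurable_sigmaAll X j).mono le_sup_right le_rfl))

omit [MeasurableSpace Ω] in
lemma indicator_mem_Icc (A : Set Ω) (ω : Ω) : A.indicator (1 : Ω → ℝ) ω ∈ Set.Icc (0 : ℝ) 1 := by
  by_cases h : ω ∈ A <;> simp [h]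

/-- The bound for events that depend on finitely many coordinates. -/
lemma abs_crossCov_window_le (hD : MeasurableSet D) (hX : ∀ t, Measurable (X t))
    (hY : ∀ t, Measurable (Y t)) (hXD : ∀ᵐ ω ∂μ, past X (-1) ω ∈ D)
    (hXerg : StationaryErgodic μ X) (hmodel : SolvesModel μ P X Y)
    (hexo : StrictlyExogenous μ X Y) (hA4 : AssumptionA4 P a e)
    {n r : ℕ} (hr : 1 < r) (hrn : r < n)
    (hb : ∑' t : Set.Ici (n - r - 1), ENNReal.ofReal (bStar (bCoeff P) t) ≠ ∞)
    {k l : ℕ} {A B : Set Ω}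
    (hA : MeasurableSet[sigmaOn (fun t ω => (Y t ω, X t ω)) (Set.Ioc (0 - k) 0)] A)
    (hB : MeasurableSet[sigmaOn (fun t ω => (Y t ω, X t ω)) (Set.Icc n (n + l))] B)
    {ε : ℝ} (hε : 0 < ε) :
    ∃ d : ℝ, ENNReal.ofReal d ≤
        ∑' t : Set.Ici (n - r - 1), ENNReal.ofReal (bStar (bCoeff P) t)
        + 2 * (∫⁻ ω, ‖X 0 ω‖ₑ ∂μ) * (∑' t : Set.Ici (n - r), ENNReal.ofReal (tailSum e t)
          + ∑' t : Set.Ici (n - r - 1),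
            ENNReal.ofReal (conv (bStar (bCoeff P)) (tailSum e) t)) ∧
      |crossCov μ (A.indicator 1) (B.indicator 1)| ≤ alphaProc μ X r + 2 * d + ε := by
  have hb0 := bCoeff_nonneg P
  have hb1 := bCoeff_le_one P
  obtain ⟨ω₀, hω₀⟩ := hXD.exists
  obtain ⟨ρ, hρ, hρD⟩ := exists_measurable_retraction hD ⟨_, hω₀⟩
  have hXD' := hXerg.ae_past_mem hX hD hXD
  obtain ⟨S, hS, hSA, hSinv⟩ := exists_window_set X Y (Y 0 ω₀) (N := 0) (M := k) (J := Set.Iic 0)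
    (fun j hj => ⟨hj.2, by have := hj.1; omega, hj.2⟩) hA
  obtain ⟨S', hS', hSB, hSinv'⟩ := exists_window_set X Y (Y 0 ω₀) (N := n + l) (M := l + 1)
    (J := Set.Ici (r : ℤ)) (fun j hj => ⟨hj.2, by have := hj.1; push_cast; omega,
      by have := hj.1; simp only [Set.mem_Ici]; omega⟩) hB
  -- Integrating out the n - r + l + 1 values at times n + l, …, r leaves the past of `Y` up to r -
  -- 1, which contains the window of `A`.
  obtain ⟨h, d, hhm, hh1, hd, hcov⟩ := exists_future_approximation (ρ := ρ) (r := r)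
    (k := (n - r) + (l + 1)) hX hY hXerg hD hXD' hρ hρD hmodel hexo hA4 (fun _ => Y 0 ω₀)
    (by push_cast [Nat.cast_sub hrn.le]; ring) hS' hSB hSinv'
  -- The past approximation costs twice the renewal value, hence the threshold ε / 2.
  obtain ⟨K, hK⟩ := ((tendsto_renewalValue_ltIndicator hb0 hb1 hb k).eventually
    (gt_mem_nhds (half_pos hε))).exists
  obtain ⟨g, hgm, hg1, hcov'⟩ := exists_past_approximation hX hY hXD' hρ hρD hmodel hexo
    (fun _ => Y 0 ω₀) hS hSA hSinv K
  have hAm : Measurable[sigmaPastPath Y X (r - 1)] (A.indicator (1 : Ω → ℝ)) :=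
    Measurable.indicator (@measurable_one ℝ Ω _ (sigmaPastPath Y X (r - 1)) _)
      (sigmaOn_prod_le_sigmaPastPath X Y (fun j hj => by have := hj.2; omega) _ hA)
  have hhall : Measurable[sigmaAll X] h :=
    hhm.mono (iSup₂_le fun j _ => (measurable_sigmaAll X j).comap_le) le_rfl
  refine ⟨d, hd.trans ?_, ?_⟩
  · refine add_le_add (ofReal_renewalValue_le_tsum hb0 hb1) ?_
    gcongr
    exact sum_tailSum_mul_renewalValue_le hb0 hb1 hA4.2.1
  · have h1 := hcov _ hAm (indicator_mem_Icc A)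
    have h2 := hcov' h hhall hh1
    have h3 : |crossCov μ g h| ≤ alphaProc μ X r :=
      abs_crossCov_le_alphaCoeff (sigmaLE_le hX 0) (sigmaGE_le hX r) hgm hg1 hhm hh1
    rw [crossCov_comm (A.indicator 1)]
    rw [crossCov_comm (A.indicator 1)] at h2
    rw [abs_le] at h1 h2 h3 ⊢
    constructor <;> linarith [h1.1, h1.2, h2.1, h2.2, h3.1, h3.2]

end Final

end InfiniteMemory

end

/-! ### From window events to the full past and future. -/

theorem theorem2
    {Ω : Type*} [MeasurableSpace Ω] (μ : Measure Ω) [IsProbabilityMeasure μ]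
    {E : Type*} [Countable E] [MeasurableSpace E] [MeasurableSingletonClass E]
    {F : Type*} [NormedAddCommGroup F] [NormedSpace ℝ F] [FiniteDimensional ℝ F]
    [MeasurableSpace F] [BorelSpace F]
    (D : Set (ℕ → F)) (hD : MeasurableSet D)
    (P : Kernel ((ℕ → E) × D) E) [IsMarkovKernel P]
    (X : ℤ → Ω → F) (hX : ∀ t, Measurable (X t))
    (Y : ℤ → Ω → E) (hY : ∀ t, Measurable (Y t))
    (hXD : ∀ᵐ ω ∂μ, InfiniteMemory.past X (-1) ω ∈ D)
    (hXerg : InfiniteMemory.StationaryErgodic μ X)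
    (hmodel : InfiniteMemory.SolvesModel μ P X Y)
    (hexo : InfiniteMemory.StrictlyExogenous μ X Y)
    (hA3 : InfiniteMemory.AssumptionA3 P)
    (a e : ℕ → ℝ) (hA4 : InfiniteMemory.AssumptionA4 P a e)
    (n r : ℕ) (hr : 1 < r) (hrn : r < n) :
    ENNReal.ofReal (InfiniteMemory.alphaProc μ (fun t ω => (Y t ω, X t ω)) n) ≤
      4 * ENNReal.ofReal (InfiniteMemory.alphaProc μ X r)
      + 2 * ∑' t : Set.Ici (n - r - 1),
          ENNReal.ofReal (InfiniteMemory.bStar (InfiniteMemory.bCoeff P) t)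
      + 4 * (∫⁻ ω, ‖X 0 ω‖ₑ ∂μ) * ∑' t : Set.Ici (n - r),
          ENNReal.ofReal (InfiniteMemory.tailSum e t)
      + 4 * (∫⁻ ω, ‖X 0 ω‖ₑ ∂μ) * ∑' t : Set.Ici (n - r - 1),
          ENNReal.ofReal (InfiniteMemory.conv
            (InfiniteMemory.bStar (InfiniteMemory.bCoeff P)) (InfiniteMemory.tailSum e) t) := by
  set sb := ∑' t : Set.Ici (n - r - 1),
    ENNReal.ofReal (InfiniteMemory.bStar (InfiniteMemory.bCoeff P) t) with hsb
  set ss := ∑' t : Set.Ici (n - r), ENNReal.ofReal (InfiniteMemory.tailSum e t)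
  set sc := ∑' t : Set.Ici (n - r - 1), ENNReal.ofReal (InfiniteMemory.conv
    (InfiniteMemory.bStar (InfiniteMemory.bCoeff P)) (InfiniteMemory.tailSum e) t)
  set α := InfiniteMemory.alphaProc μ X r with hα
  set R := 4 * ENNReal.ofReal α + 2 * sb + 4 * (∫⁻ ω, ‖X 0 ω‖ₑ ∂μ) * ss
    + 4 * (∫⁻ ω, ‖X 0 ω‖ₑ ∂μ) * sc with hR
  -- A finite right-hand side makes the tail of b* summable, as the past approximation requires.
  by_cases hRtop : R = ⊤
  · rw [hRtop]; exact le_top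
  have hb : sb ≠ ⊤ := by
    intro h
    exact hRtop (by simp [hR, h])
  set V : ℤ → Ω → E × F := fun t ω => (Y t ω, X t ω) with hV
  have hVm : ∀ t, Measurable (V t) := fun t => (hY t).prodMk (hX t)
  refine ENNReal.ofReal_le_of_le_toReal (csSup_le
    ⟨_, ∅, ∅, @MeasurableSet.empty _ (InfiniteMemory.sigmaLE V 0),
      @MeasurableSet.empty _ (InfiniteMemory.sigmaGE V n), rfl⟩ ?_)
  rintro c ⟨A, B, hA, hB, rfl⟩
  have hA0 := InfiniteMemory.sigmaLE_le hVm 0 _ hA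
  have hB0 := InfiniteMemory.sigmaGE_le hVm n _ hB
  rw [← InfiniteMemory.crossCov_indicator hA0 hB0]
  refine le_of_forall_pos_le_add fun ε hε => ?_
  -- Replacing `A` and `B` costs 2ε/5 each, and the window bound costs another ε/5.
  obtain ⟨k, A', hA', hAA'⟩ :=
    InfiniteMemory.exists_measurableSet_integral_abs_indicator_sub_lt (μ := μ)
      (𝓕 := fun m : ℕ => InfiniteMemory.sigmaOn V (Set.Ioc (0 - (m : ℤ)) 0))
      (fun i j hij => InfiniteMemory.sigmaOn_mono V (Set.Ioc_subset_Ioc_left (by omega)))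
      (fun m => InfiniteMemory.sigmaOn_le hVm _)
      (InfiniteMemory.sigmaLE_le_iSup_sigmaOn V 0 _ hA) (ε := ε / 5) (by positivity)
  obtain ⟨l, B', hB', hBB'⟩ :=
    InfiniteMemory.exists_measurableSet_integral_abs_indicator_sub_lt (μ := μ)
      (𝓕 := fun m : ℕ => InfiniteMemory.sigmaOn V (Set.Icc (n : ℤ) (n + (m : ℤ))))
      (fun i j hij => InfiniteMemory.sigmaOn_mono V (Set.Icc_subset_Icc_right (by omega)))
      (fun m => InfiniteMemory.sigmaOn_le hVm _)
      (InfiniteMemory.sigmaGE_le_iSup_sigmaOn V n _ hB) (ε := ε / 5) (by positivity)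
  obtain ⟨d, hd, hcov⟩ := InfiniteMemory.abs_crossCov_window_le hD hX hY hXD hXerg hmodel hexo
    hA4 hr hrn hb hA' hB' (ε := ε / 5) (by positivity)
  have hind : ∀ {C : Set Ω}, MeasurableSet C → Measurable (C.indicator (1 : Ω → ℝ)) :=
    fun hC => measurable_one.indicator hC
  have hA'0 := InfiniteMemory.sigmaOn_le hVm _ _ hA'
  have hB'0 := InfiniteMemory.sigmaOn_le hVm _ _ hB'
  have h1 := InfiniteMemory.abs_crossCov_sub_le (μ := μ) (hind hA0) (hind hA'0) (hind hB0)
    (InfiniteMemory.indicator_mem_Icc A) (InfiniteMemory.indicator_mem_Icc A')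
    (InfiniteMemory.indicator_mem_Icc B)
  have h2 := InfiniteMemory.abs_crossCov_sub_le (μ := μ) (hind hB0) (hind hB'0) (hind hA'0)
    (InfiniteMemory.indicator_mem_Icc B) (InfiniteMemory.indicator_mem_Icc B')
    (InfiniteMemory.indicator_mem_Icc A')
  rw [InfiniteMemory.crossCov_comm, InfiniteMemory.crossCov_comm (B'.indicator 1)] at h2
  have hbound : α + 2 * d ≤ R.toReal := by
    rw [← ENNReal.ofReal_le_iff_le_toReal hRtop]
    calc ENNReal.ofReal (α + 2 * d) ≤ ENNReal.ofReal α + 2 * ENNReal.ofReal d := by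
          refine ENNReal.ofReal_add_le.trans ?_
          rw [ENNReal.ofReal_mul zero_le_two]
          simp
      _ ≤ 4 * ENNReal.ofReal α + 2 * (sb + 2 * (∫⁻ ω, ‖X 0 ω‖ₑ ∂μ) * (ss + sc)) := by
          gcongr
          exact le_mul_of_one_le_left' (by norm_num)
      _ = R := by rw [hR]; ring
  rw [abs_le] at h1 h2 hcov ⊢
  constructor <;> linarith [h1.1, h1.2, h2.1, h2.2, hcov.1, hcov.2]
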